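/- Let $\alpha,\beta>-1$, $0<c_-\le c_+<\infty$ and $\gamma=\max\{\alpha,\beta,-\tfrac12\}$. There is a constant $c_0\ge 0$, depending only on $\alpha,\beta,c_-,c_+$, with $c_0=0$ if $\gamma>-\tfrac12$, such that for all $c_1>c_0$ and all $c_2$ there is a constant $C>0$, depending only on $\alpha,\beta,c_-,c_+,c_1,c_2$, for which the following holds. Let $\mu(x)=g(x)(1-x)^\alpha(1+x)^\beta$ be a modified Jacobi weight function on $(-1,1)$, where $g$ is measurable with $c_-\le g\le c_+$ almost everywhere and $\int_{-1}^1\mu(x)\,dx=1$. Let $1\le N\le M$ be integers with $$c_1N^{2(\gamma+1)}\le M\le c_2N^{2(\gamma+1)},$$ and let $x_0,\dots,x_M\in[-1,1]$ be the nodes with $\int_{-1}^{x_m}\mu(x)\,dx=m/M$ for $m=0,\dots,M$. For $f\in C([-1,1])$ (complex-valued) let $F_{M,N}(f)$ be the polynomial of degree at most $N$ that minimises $\sum_{m=0}^M|f(x_m)-p(x_m)|^2$ over all such polynomials $p$, and let $$\kappa(F_{M,N})=\sup_{f\in C([-1,1])}\ \lim_{\delta\to0^+}\ \sup_{\substack{h\in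 C([-1,1])\\ 0<\|h\|_{M,\infty}\le\delta}}\frac{\|F_{M,N}(f+h)-F_{M,N}(f)\|_\infty}{\|h\|_{M,\infty}},\qquad \|h\|_{M,\infty}=\max_{0\le m\le M}|h(x_m)| .$$ Then $$1\le\kappa(F_{M,N})\le C\sqrt M,$$ and for every $\theta>1$ and every function $f$ that is analytic on the Bernstein ellipse $E_\theta$ (the open region bounded by the ellipse with foci $\pm1$ whose semiaxes have sum $\theta$), $$\|f-F_{M,N}(f)\|_\infty\le\frac{C\sqrt M}{\theta-1}\,\theta^{-(M/c_2)^{1/(2(\gamma+1))}}\,\|f\|_{E_\theta},\qquad \|f\|_{E_\theta}=\sup_{z\in E_\theta}|f(z)| .$$ In particular, when $M\le N^{2(\gamma+1)}$ one may take $c_2=1$ (if $c_1>c_0$ permits), and the rate is $\theta^{-M^{1/(2(\gamma+1))}}$. -/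

import Mathlib

open MeasureTheory Filter Topology
open scoped ENNReal

namespace LSQ

/-- The interval `[-1, 1]`. -/
abbrev I : Type := Set.Icc (-1 : ℝ) 1

/-- The modified Jacobi function `g(x) (1 - x)^α (1 + x)^β`. -/
noncomputable def jacobiWeight (g : ℝ → ℝ) (α β : ℝ) (x : ℝ) : ℝ :=
  g x * (1 - x) ^ α * (1 + x) ^ β

/-- The factor `g` is measurable on `(-1, 1)`, lies between `lo` and `hi` almost everywhere, and
`g(x) (1 - x)^α (1 + x)^β` has integral one. -/
structure IsModifiedJacobi (g : ℝ → ℝ) (α β lo hi : ℝ) : Prop where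
  meas : AEStronglyMeasurable g (volume.restrict (Set.Ioo (-1 : ℝ) 1))
  bounds : ∀ᵐ x ∂(volume.restrict (Set.Ioo (-1 : ℝ) 1)), lo ≤ g x ∧ g x ≤ hi
  normalized : ∫ x in (-1 : ℝ)..1, jacobiWeight g α β x = 1

/-- The nodes `x_0, …, x_M` are equidistributed according to `w`: `m / M = ∫_{-1}^{x_m} w`. -/
def Equidistributed (w : ℝ → ℝ) {M : ℕ} (x : Fin (M + 1) → I) : Prop :=
  ∀ m : Fin (M + 1), ((m : ℕ) : ℝ) / (M : ℝ) = ∫ t in (-1 : ℝ)..(x m : ℝ), w t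

/-- The discrete uniform seminorm `max_{0 ≤ m ≤ M} |f(x_m)|` (the norm of a finite product is the
maximum norm). -/
noncomputable def gridNorm {M : ℕ} (x : Fin (M + 1) → I) (f : C(I, ℂ)) : ℝ :=
  ‖(fun m => f (x m) : Fin (M + 1) → ℂ)‖

/-- The supremum of `‖F(f + h) - F(f)‖_∞ / ‖h‖_{M,∞}` over `h` with `0 < ‖h‖_{M,∞} ≤ δ`. -/
noncomputable def localCond {M : ℕ} (x : Fin (M + 1) → I) (F : C(I, ℂ) → C(I, ℂ))
    (f : C(I, ℂ)) (δ : ℝ) : ℝ≥0∞ :=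
  ⨆ (h : C(I, ℂ)) (_ : 0 < gridNorm x h ∧ gridNorm x h ≤ δ),
    ENNReal.ofReal (‖F (f + h) - F f‖ / gridNorm x h)

/-- The (absolute) condition number of `F` with respect to the nodes `x`. The infimum over `δ > 0`
is the limit as `δ → 0+`, see `tendsto_localCond`. -/
noncomputable def condNumber {M : ℕ} (x : Fin (M + 1) → I) (F : C(I, ℂ) → C(I, ℂ)) : ℝ≥0∞ :=
  ⨆ f : C(I, ℂ), ⨅ (δ : ℝ) (_ : 0 < δ), localCond x F f δ

theorem tendsto_localCond {M : ℕ} (x : Fin (M + 1) → I) (F : C(I, ℂ) → C(I, ℂ))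
    (f : C(I, ℂ)) :
    Tendsto (localCond x F f) (𝓝[>] 0) (𝓝 (⨅ (δ : ℝ) (_ : 0 < δ), localCond x F f δ)) := by
  have hm : Monotone (localCond x F f) := by
    intro a b hab
    exact iSup_mono fun h => iSup_const_mono fun hh => ⟨hh.1, hh.2.trans hab⟩
  have := hm.tendsto_nhdsGT 0
  rwa [sInf_image] at this

/-- A polynomial with complex coefficients as a continuous function on `[-1, 1]`. -/
noncomputable def polyFun (p : Polynomial ℂ) : C(I, ℂ) where
  toFun t := p.eval ((t : ℝ) : ℂ)
  continuous_toFun := by fun_prop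

/-- The sum of squared residuals `∑_{m=0}^M |f(x_m) - p(x_m)|²`. -/
noncomputable def residual {M : ℕ} (x : Fin (M + 1) → I) (f : C(I, ℂ)) (p : Polynomial ℂ) : ℝ :=
  ∑ m : Fin (M + 1), ‖f (x m) - polyFun p (x m)‖ ^ 2

/-- `p` is a minimiser of the sum of squared residuals among polynomials of degree at most `N`. -/
def IsLeastSquares {M : ℕ} (x : Fin (M + 1) → I) (N : ℕ) (f : C(I, ℂ))
    (p : Polynomial ℂ) : Prop :=
  p.natDegree ≤ N ∧ ∀ q : Polynomial ℂ, q.natDegree ≤ N → residual x f p ≤ residual x f q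

theorem exists_isLeastSquares {M : ℕ} (x : Fin (M + 1) → I) (N : ℕ) (f : C(I, ℂ)) :
    ∃ p, IsLeastSquares x N f p := by
  let L : Polynomial ℂ →ₗ[ℂ] EuclideanSpace ℂ (Fin (M + 1)) :=
    { toFun := fun p => WithLp.toLp 2 fun m => polyFun p (x m)
      map_add' := by intro p q; ext m; simp [polyFun]
      map_smul' := by intro c p; ext m; simp [polyFun] }
  let v : EuclideanSpace ℂ (Fin (M + 1)) := WithLp.toLp 2 fun m => f (x m)
  let V := (Polynomial.degreeLE ℂ (N : WithBot ℕ)).map L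
  have hres : ∀ p, residual x f p = ‖v - L p‖ ^ 2 := by
    intro p
    rw [EuclideanSpace.norm_sq_eq]
    rfl
  obtain ⟨p, hp, hpL⟩ := Submodule.mem_map.1 (V.starProjection_apply_mem v)
  refine ⟨p, Polynomial.natDegree_le_iff_degree_le.2 (Polynomial.mem_degreeLE.1 hp), ?_⟩
  intro q hq
  rw [hres, hres, hpL]
  have hqV : L q ∈ V := Submodule.mem_map_of_mem
    (Polynomial.mem_degreeLE.2 (Polynomial.natDegree_le_iff_degree_le.1 hq))
  have : ‖v - V.starProjection v‖ ≤ ‖v - L q‖ := by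
    rw [Submodule.starProjection_minimal]
    exact ciInf_le ⟨0, by rintro _ ⟨y, rfl⟩; exact norm_nonneg _⟩ (⟨L q, hqV⟩ : V)
  gcongr

/-- The discrete least-squares approximation of degree `N` from the nodes `x`. For `N ≤ M` and
distinct nodes the minimiser is unique. -/
noncomputable def leastSquares {M : ℕ} (x : Fin (M + 1) → I) (N : ℕ) (f : C(I, ℂ)) : C(I, ℂ) :=
  polyFun (exists_isLeastSquares x N f).choose

/-- The (open) Bernstein ellipse with parameter `θ`: its foci are `±1`, its semiaxes are
`(θ + θ⁻¹) / 2` and `(θ - θ⁻¹) / 2`, with sum `θ`. -/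
def bernsteinEllipse (θ : ℝ) : Set ℂ := {z | ‖z - 1‖ + ‖z + 1‖ < θ + θ⁻¹}

/-- The supremum of `|φ|` over `E` (possibly infinite). -/
noncomputable def supNormOn (E : Set ℂ) (φ : ℂ → ℂ) : ℝ≥0∞ := ⨆ z ∈ E, ‖φ z‖ₑ

end LSQ

/-! Everything reduces to a norming inequality: a polynomial of degree at most `N` is bounded on the
whole interval by a constant times its maximum over the nodes (`exists_norming`). On the nodes,
least squares is an orthogonal projection, hence a contraction in the Euclidean norm. Comparing that
norm with the maximum norm costs a factor of order `√M`, and the norming inequality carries the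
bound from the nodes to the interval. This gives the condition number and quasi-optimality; the rate
follows by comparison with a truncated Chebyshev series (`exists_polynomial_approx`).

For the norming inequality put `q = γ + 1` and let `|p|` attain its maximum `B` at `cos t`, near the
endpoint `1` say. A short arc of length `h` at angle `t` has mass at least of order `h t ^ (2q -
1)`. If `t ≥ K / N` with `K` large, an arc of length `1 / (6N)` therefore has mass above `1 / M` and
contains a node, and a Bernstein inequality shows that `|p|` is at least `B / 2` there.

If `t ≤ K / N`, the maximum lies within `O(N⁻²)` of the endpoint. In a neighbourhood of size `R /
N²` there are of order `R ^ q` nodes with gaps of order `N⁻²` (for fixed `R`), while `p` grows by at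
most `exp(O(√R))` on a comparable complex disc. Since `q > 1/2`, interpolation at `n ~ R ^ q` of
these nodes has a remainder of at most `2⁻ⁿ exp(O(√R)) B ≤ B / 2` once `R` is a large constant, and
the remainder is absorbed. If `q = 1/2` this fails, but with enough oversampling `K = 0` is allowed
and the first case is all there is; this is the role of `c₀`. For the finitely many small `N` the
number of nodes is bounded, and Lagrange interpolation suffices. -/

namespace LSQ

open Polynomial

/-! ### Growth and Bernstein inequalities for polynomials -/

/-- **Bernstein–Walsh inequality** in the Joukowsky parametrisation. -/
theorem norm_eval_joukowsky_le {p : ℂ[X]} {N : ℕ} (hp : p.natDegree ≤ N) {B : ℝ}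
    (hB : ∀ t : ℝ, t ∈ Set.Icc (-1 : ℝ) 1 → ‖p.eval (t : ℂ)‖ ≤ B) {w : ℂ} (hw : 1 ≤ ‖w‖) :
    ‖p.eval ((w + w⁻¹) / 2)‖ ≤ ‖w‖ ^ N * B := by
  -- This is `v ^ N * p((v + v⁻¹) / 2)` with the pole at `0` cancelled, so the maximum principle on
  -- the unit disc applies at `w⁻¹`.
  let F : ℂ → ℂ := fun v => ∑ k ∈ Finset.range (N + 1),
    p.coeff k * (((v ^ 2 + 1) / 2) ^ k * v ^ (N - k))
  have hF : ∀ v : ℂ, v ≠ 0 → F v = v ^ N * p.eval ((v + v⁻¹) / 2) := by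
    intro v hv
    rw [Polynomial.eval_eq_sum_range' (Nat.lt_succ_of_le hp), Finset.mul_sum]
    refine Finset.sum_congr rfl fun k hk => ?_
    have hk' : k ≤ N := Nat.lt_succ_iff.1 (Finset.mem_range.1 hk)
    have h1 : v ^ N = v ^ (N - k) * v ^ k := by rw [← pow_add, Nat.sub_add_cancel hk']
    have h2 : (v ^ 2 + 1) / 2 = v * ((v + v⁻¹) / 2) := by field_simp
    rw [h1, h2, mul_pow]
    ring
  have hd : Differentiable ℂ F := by
    intro v
    simp only [F]
    fun_prop
  have hw0 : w ≠ 0 := by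
    rintro rfl
    simp at hw
    linarith
  have hcirc : ∀ v ∈ frontier (Metric.ball (0 : ℂ) 1), ‖F v‖ ≤ B := by
    intro v hv
    rw [frontier_ball _ one_ne_zero, mem_sphere_zero_iff_norm] at hv
    have hv0 : v ≠ 0 := by
      rintro rfl
      simp at hv
    have hvre : (v + v⁻¹) / 2 = ((v.re : ℝ) : ℂ) := by
      rw [Complex.inv_eq_conj hv, Complex.add_conj]
      push_cast
      ring
    rw [hF v hv0, norm_mul, norm_pow, hv, one_pow, one_mul, hvre]
    exact hB _ (abs_le.1 (hv ▸ Complex.abs_re_le_norm v))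
  have hmem : w⁻¹ ∈ closure (Metric.ball (0 : ℂ) 1) := by
    rw [closure_ball _ one_ne_zero, mem_closedBall_zero_iff, norm_inv]
    exact inv_le_one_of_one_le₀ hw
  have := Complex.norm_le_of_forall_mem_frontier_norm_le Metric.isBounded_ball
    hd.diffContOnCl hcirc hmem
  rw [hF _ (inv_ne_zero hw0), inv_inv, norm_mul, norm_pow, norm_inv, inv_pow,
    add_comm, inv_mul_le_iff₀ (by positivity)] at this
  exact this

/-- Growth of a polynomial in a disc around the endpoint `1`. -/
theorem norm_eval_le_of_mem_closedBall_one {p : ℂ[X]} {N : ℕ} (hp : p.natDegree ≤ N) {B : ℝ}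
    (hB : ∀ t : ℝ, t ∈ Set.Icc (-1 : ℝ) 1 → ‖p.eval (t : ℂ)‖ ≤ B) {z : ℂ} {s : ℝ}
    (hz : ‖z - 1‖ ≤ s) : ‖p.eval z‖ ≤ Real.exp (N * (2 * √(2 * s))) * B := by
  have hB0 : 0 ≤ B := (norm_nonneg _).trans (hB 0 (by simp))
  -- The Joukowsky preimages of `z` are `z + d` and `z - d`; their product is `1`, so one of them
  -- has modulus at least `1`.
  obtain ⟨d, hd⟩ := IsAlgClosed.exists_pow_nat_eq (z ^ 2 - 1) (n := 2) two_pos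
  have hmul : (z + d) * (z - d) = 1 := by linear_combination -hd
  have key : ∀ w : ℂ, 1 ≤ ‖w‖ → (w + w⁻¹) / 2 = z →
      ‖p.eval z‖ ≤ Real.exp (N * (2 * √(2 * s))) * B := by
    intro w hw hwz
    have hw0 : w ≠ 0 := by
      rintro rfl
      simp at hw
      linarith
    have hsq : (w - 1) ^ 2 = 2 * w * (z - 1) := by
      rw [← hwz]
      field_simp
      ring
    have hn : ‖w - 1‖ ^ 2 ≤ 2 * ‖w‖ * s := by
      rw [← norm_pow, hsq, norm_mul, norm_mul]
      simp only [Complex.norm_ofNat]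
      gcongr
    have h1 : ‖w‖ - 1 ≤ ‖w - 1‖ := by simpa using norm_sub_norm_le w 1
    have hs : 0 ≤ s := (norm_nonneg _).trans hz
    have h2 : √‖w‖ ≤ 1 + √(2 * s) := by
      set u := √‖w‖
      set v := √(2 * s)
      have hu : u ^ 2 = ‖w‖ := Real.sq_sqrt (norm_nonneg _)
      have hv : v ^ 2 = 2 * s := Real.sq_sqrt (by positivity)
      have hu1 : 1 ≤ u := Real.one_le_sqrt.2 hw
      have hv0 : 0 ≤ v := Real.sqrt_nonneg _
      have h3 : (u ^ 2 - 1) ^ 2 ≤ (u * v) ^ 2 := by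
        calc (u ^ 2 - 1) ^ 2 ≤ ‖w - 1‖ ^ 2 := by
              rw [hu]
              gcongr
          _ ≤ 2 * ‖w‖ * s := hn
          _ = (u * v) ^ 2 := by rw [mul_pow, hu, hv]; ring
      have h4 : u ^ 2 - 1 ≤ u * v := (sq_le_sq₀ (by nlinarith) (by positivity)).1 h3
      by_contra! h5
      nlinarith
    have h3 : ‖w‖ ≤ Real.exp (2 * √(2 * s)) := by
      rw [← Real.sq_sqrt (norm_nonneg w), two_mul, Real.exp_add, ← sq]
      gcongr
      exact h2.trans (by linarith [Real.add_one_le_exp (√(2 * s))])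
    rw [← hwz]
    refine (norm_eval_joukowsky_le hp hB hw).trans ?_
    rw [Real.exp_nat_mul]
    gcongr
  rcases le_total 1 ‖z + d‖ with h | h
  · refine key _ h ?_
    rw [inv_eq_of_mul_eq_one_right hmul]
    ring
  · have : 1 ≤ ‖z - d‖ := by
      have h1 : ‖z + d‖ * ‖z - d‖ = 1 := by rw [← norm_mul, hmul, norm_one]
      nlinarith [norm_nonneg (z - d)]
    refine key _ this ?_
    rw [inv_eq_of_mul_eq_one_left hmul]
    ring

/-- A Bernstein inequality (with a constant that is not sharp). -/
theorem norm_eval_cos_sub_le {p : ℂ[X]} {N : ℕ} (hp : p.natDegree ≤ N) (hN : 1 ≤ N) {B : ℝ}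
    (hB : ∀ t : ℝ, t ∈ Set.Icc (-1 : ℝ) 1 → ‖p.eval (t : ℂ)‖ ≤ B) (a b : ℝ) :
    ‖p.eval (Real.cos b : ℂ) - p.eval (Real.cos a : ℂ)‖ ≤ 3 * N * B * |b - a| := by
  have hB0 : 0 ≤ B := (norm_nonneg _).trans (hB 0 (by simp))
  have hN0 : (0 : ℝ) < N := by exact_mod_cast hN
  let T : ℂ → ℂ := fun z => p.eval (Complex.cos z)
  have hT : Differentiable ℂ T := fun z => by
    simp only [T]
    exact (p.differentiable.differentiableAt).comp z Complex.differentiable_cos.differentiableAt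
  have hcos : ∀ z : ℂ, Complex.cos z =
      (Complex.exp (z * Complex.I) + (Complex.exp (z * Complex.I))⁻¹) / 2 := by
    intro z
    rw [Complex.cos, ← Complex.exp_neg, neg_mul]
  have grow' : ∀ z : ℂ, z.im ≤ 0 → ‖T z‖ ≤ Real.exp (N * |z.im|) * B := by
    intro z hz
    simp only [T]
    rw [hcos]
    have hnorm : ‖Complex.exp (z * Complex.I)‖ = Real.exp |z.im| := by
      rw [Complex.norm_exp, abs_of_nonpos hz]
      simp
    refine (norm_eval_joukowsky_le hp hB ?_).trans ?_
    · rw [hnorm]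
      exact Real.one_le_exp (abs_nonneg _)
    · rw [hnorm, Real.exp_nat_mul]
  have grow : ∀ z : ℂ, ‖T z‖ ≤ Real.exp (N * |z.im|) * B := by
    intro z
    rcases le_total z.im 0 with h | h
    · exact grow' z h
    · have := grow' (-z) (by simpa using h)
      simpa [T] using this
  -- Cauchy's estimate on a circle of radius `1 / N`, where the growth factor is at most `exp 1 ≤
  -- 3`.
  have hderiv : ∀ x : ℝ, ‖deriv T x‖ ≤ 3 * N * B := by
    intro x
    have h1 : ∀ z ∈ Metric.sphere (x : ℂ) (1 / N), ‖T z‖ ≤ 3 * B := by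
      intro z hz
      refine (grow z).trans ?_
      have h2 : |z.im| ≤ 1 / N := by
        have := Complex.abs_im_le_norm (z - x)
        rw [mem_sphere_iff_norm] at hz
        rw [hz] at this
        simpa using this
      have h3 : N * |z.im| ≤ 1 := by
        rw [le_div_iff₀ hN0] at h2
        linarith
      gcongr
      exact (Real.exp_le_exp.2 h3).trans (by linarith [Real.exp_one_lt_d9])
    have := Complex.norm_deriv_le_of_forall_mem_sphere_norm_le (by positivity)
      hT.diffContOnCl h1
    refine this.trans (le_of_eq ?_)
    field_simp
  have hreal : ∀ x : ℝ, HasDerivAt (fun y : ℝ => T y) (deriv T x) x := fun x =>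
    (hT x).hasDerivAt.comp_ofReal
  have := convex_univ.norm_image_sub_le_of_norm_hasDerivWithin_le
    (f := fun y : ℝ => T y) (fun x _ => (hreal x).hasDerivWithinAt) (fun x _ => hderiv x)
    (Set.mem_univ a) (Set.mem_univ b)
  simpa [T, Real.norm_eq_abs] using this

/-! ### Interpolation at separated nodes -/

/-- Stability of polynomial interpolation at separated nodes. -/
theorem norm_eval_le_of_separated {n : ℕ} {p : ℂ[X]} (hp : p.degree < n) {v : Fin n → ℂ}
    {d D A : ℝ} (hd : 0 < d) (hsep : ∀ i j, i ≠ j → d ≤ ‖v i - v j‖)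
    (hA : ∀ i, ‖p.eval (v i)‖ ≤ A) {z : ℂ} (hz : ∀ i, ‖z - v i‖ ≤ D) :
    ‖p.eval z‖ ≤ n * (D / d) ^ (n - 1) * A := by
  have hinj : Set.InjOn v (Finset.univ : Finset (Fin n)) := by
    intro i _ j _ hij
    by_contra hne
    have := hsep i j hne
    rw [hij, sub_self, norm_zero] at this
    linarith
  have h := Lagrange.eq_interpolate (f := p) hinj (by simpa using hp)
  have hb : ∀ i, ‖(Lagrange.basis Finset.univ v i).eval z‖ ≤ (D / d) ^ (n - 1) := by
    intro i
    rw [Lagrange.basis, eval_prod, norm_prod]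
    have hcard : (Finset.univ.erase i).card = n - 1 := by simp
    rw [← hcard, ← Finset.prod_const]
    refine Finset.prod_le_prod (fun _ _ => norm_nonneg _) fun j hj => ?_
    have hij := hsep i j (Finset.ne_of_mem_erase hj).symm
    rw [Lagrange.basisDivisor]
    simp only [eval_mul, eval_C, eval_sub, eval_X, norm_mul, norm_inv]
    rw [inv_mul_eq_div]
    exact div_le_div₀ ((norm_nonneg _).trans (hz j)) (hz j) hd hij
  rw [h, Lagrange.interpolate_apply, eval_finsetSum]
  refine (norm_sum_le _ _).trans ?_
  calc ∑ i, ‖(C (p.eval (v i)) * Lagrange.basis Finset.univ v i).eval z‖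
      ≤ ∑ _i : Fin n, A * (D / d) ^ (n - 1) := by
        refine Finset.sum_le_sum fun i _ => ?_
        rw [eval_mul, eval_C, norm_mul]
        exact mul_le_mul (hA i) (hb i) (norm_nonneg _) ((norm_nonneg _).trans (hA i))
    _ = n * (D / d) ^ (n - 1) * A := by
        simp
        ring

/-- Interpolation of a polynomial of arbitrary degree at separated nodes in a disc, with the
remainder estimated by the maximum modulus principle. -/
theorem norm_eval_le_of_separated_of_growth {n : ℕ} {p : ℂ[X]} {v : Fin n → ℂ} {c : ℂ}
    {d r A W : ℝ} (hd : 0 < d) (hr : 0 < r) (hsep : ∀ i j, i ≠ j → d ≤ ‖v i - v j‖)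
    (hv : ∀ i, ‖v i - c‖ ≤ r) (hA : ∀ i, ‖p.eval (v i)‖ ≤ A) (hA0 : 0 ≤ A)
    (hW : ∀ z : ℂ, ‖z - c‖ = 5 * r → ‖p.eval z‖ ≤ W) {z : ℂ} (hz : ‖z - c‖ ≤ r) :
    ‖p.eval z‖ ≤ (1 / 2) ^ n * W + 2 * (n * (6 * r / d) ^ (n - 1) * A) := by
  set Λ := (n : ℝ) * (6 * r / d) ^ (n - 1) * A with hΛ
  have hΛ0 : 0 ≤ Λ := by positivity
  set ω := Lagrange.nodal Finset.univ v with hω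
  have hmonic : ω.Monic := Lagrange.nodal_monic
  -- `L` interpolates `p` at the nodes and `ω * Q` is the remainder. On the circle of radius `5 *
  -- r`, `|ω| ≥ (4r)ⁿ`, whereas `|ω| ≤ (2r)ⁿ` at `z`; the quotient is the gain `2⁻ⁿ`.
  set L := p %ₘ ω
  set Q := p /ₘ ω
  have hdec : ∀ y, p.eval y = L.eval y + ω.eval y * Q.eval y := by
    intro y
    rw [← eval_mul, ← eval_add, modByMonic_add_div p ω]
  have hLdeg : L.degree < n := by
    have := degree_modByMonic_lt p hmonic
    rwa [hω, Lagrange.degree_nodal, Finset.card_univ, Fintype.card_fin] at this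
  have hLA : ∀ i, ‖L.eval (v i)‖ ≤ A := by
    intro i
    have h0 : ω.eval (v i) = 0 := Lagrange.eval_nodal_at_node (Finset.mem_univ i)
    have := hdec (v i)
    rw [h0, zero_mul, add_zero] at this
    rw [← this]
    exact hA i
  have hL : ∀ y : ℂ, ‖y - c‖ ≤ 5 * r → ‖L.eval y‖ ≤ Λ := by
    intro y hy
    refine norm_eval_le_of_separated hLdeg hd hsep hLA fun i => ?_
    calc ‖y - v i‖ = ‖(y - c) - (v i - c)‖ := by ring_nf
      _ ≤ ‖y - c‖ + ‖v i - c‖ := norm_sub_le _ _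
      _ ≤ 6 * r := by linarith [hv i]
  have hω_low : ∀ y : ℂ, ‖y - c‖ = 5 * r → (4 * r) ^ n ≤ ‖ω.eval y‖ := by
    intro y hy
    rw [hω, Lagrange.eval_nodal, norm_prod]
    calc (4 * r) ^ n = ∏ _i : Fin n, (4 * r) := by simp
      _ ≤ _ := by
        refine Finset.prod_le_prod (fun _ _ => by positivity) fun i _ => ?_
        have h1 := norm_sub_norm_le (y - c) (v i - c)
        rw [sub_sub_sub_cancel_right] at h1
        linarith [hv i]
  have hω_up : ‖ω.eval z‖ ≤ (2 * r) ^ n := by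
    rw [hω, Lagrange.eval_nodal, norm_prod]
    calc _ ≤ ∏ _i : Fin n, (2 * r) := by
          refine Finset.prod_le_prod (fun _ _ => norm_nonneg _) fun i _ => ?_
          have h1 := norm_sub_le (z - c) (v i - c)
          rw [sub_sub_sub_cancel_right] at h1
          linarith [hv i]
      _ = (2 * r) ^ n := by simp
  have hr5 : 5 * r ≠ 0 := by positivity
  have hQ : ‖Q.eval z‖ ≤ (W + Λ) / (4 * r) ^ n := by
    refine Complex.norm_le_of_forall_mem_frontier_norm_le (U := Metric.ball c (5 * r))
      (f := fun y => Q.eval y) Metric.isBounded_ball Q.differentiable.diffContOnCl ?_ ?_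
    · intro y hy
      rw [frontier_ball _ hr5, mem_sphere_iff_norm] at hy
      rw [le_div_iff₀ (by positivity)]
      have h1 : ω.eval y * Q.eval y = p.eval y - L.eval y := by
        rw [hdec y]
        ring
      calc ‖Q.eval y‖ * (4 * r) ^ n ≤ ‖Q.eval y‖ * ‖ω.eval y‖ := by
            gcongr
            exact hω_low y hy
        _ = ‖p.eval y - L.eval y‖ := by rw [← h1, norm_mul, mul_comm]
        _ ≤ W + Λ := (norm_sub_le _ _).trans (add_le_add (hW y hy) (hL y hy.le))
    · rw [closure_ball _ hr5, mem_closedBall_iff_norm]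
      linarith
  have hW0 : 0 ≤ W + Λ := by
    have h1 := hW (c + (5 * r : ℝ)) (by
      rw [add_sub_cancel_left, Complex.norm_real, Real.norm_of_nonneg (by positivity)])
    linarith [norm_nonneg (p.eval (c + (5 * r : ℝ)))]
  rw [hdec z]
  calc ‖L.eval z + ω.eval z * Q.eval z‖ ≤ Λ + (2 * r) ^ n * ((W + Λ) / (4 * r) ^ n) := by
        refine (norm_add_le _ _).trans (add_le_add (hL z (by linarith)) ?_)
        rw [norm_mul]
        gcongr
    _ = Λ + (1 / 2) ^ n * (W + Λ) := by
        have : (4 * r) ^ n = 2 ^ n * (2 * r) ^ n := by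
          rw [← mul_pow]
          ring
        rw [this, div_pow, one_pow]
        field_simp
    _ ≤ _ := by
        have : ((1 : ℝ) / 2) ^ n ≤ 1 := pow_le_one₀ (by norm_num) (by norm_num)
        nlinarith

/-! ### Covering sets away from the endpoint -/

/-- Every interval in `[-1/2, 1]` on which `(1 - x)^q` varies by more than `1 / κ` meets `S`. -/
def Covers (q κ : ℝ) (S : Set ℝ) : Prop :=
  ∀ a b : ℝ, -1 / 2 ≤ a → a ≤ b → b ≤ 1 → 1 < κ * ((1 - a) ^ q - (1 - b) ^ q) →
    ∃ s ∈ S, a ≤ s ∧ s ≤ b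

theorem mul_rpow_sub_one_le_rpow_sub_rpow {m u v : ℝ} (hm : 1 ≤ m) (hu : 0 ≤ u) (huv : u ≤ v) :
    (v - u) * u ^ (m - 1) ≤ v ^ m - u ^ m := by
  have h : ∀ x : ℝ, 0 ≤ x → x ^ m = x * x ^ (m - 1) := by
    intro x hx
    conv_lhs => rw [show m = 1 + (m - 1) by ring]
    rw [Real.rpow_add_of_nonneg hx zero_le_one (by linarith), Real.rpow_one]
  rw [h u hu, h v (hu.trans huv)]
  have h1 : u ^ (m - 1) ≤ v ^ (m - 1) := Real.rpow_le_rpow hu huv (by linarith)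
  nlinarith [mul_le_mul_of_nonneg_left h1 (hu.trans huv)]

theorem le_sin_half_add_sub {t h : ℝ} (ht0 : 0 ≤ t) (ht : t ≤ Real.pi / 2) (hh0 : 0 ≤ h)
    (hh : h ≤ 1 / 6) : h / 8 ≤ Real.sin ((t + h) / 2) - Real.sin (t / 2) := by
  have hpi := Real.pi_gt_three
  have hpi4 := Real.pi_le_four
  have h1 : Real.sin ((t + h) / 2) - Real.sin (t / 2) =
      2 * Real.sin (h / 4) * Real.cos (t / 2 + h / 4) := by
    rw [Real.sin_sub_sin]
    ring_nf
  have h2 : h / 8 ≤ Real.sin (h / 4) := by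
    refine le_trans ?_ (Real.mul_le_sin (x := h / 4) (by linarith) (by linarith))
    have : 1 / 2 ≤ 2 / Real.pi := by
      rw [div_le_div_iff₀ (by norm_num) Real.pi_pos]
      linarith
    nlinarith
  have h3 : 1 / 2 ≤ Real.cos (t / 2 + h / 4) := by
    rw [← Real.cos_pi_div_three]
    exact Real.cos_le_cos_of_nonneg_of_le_pi (by linarith) (by linarith) (by linarith)
  rw [h1]
  nlinarith

/-- Since `1 - cos u = 2 sin² (u / 2)`, the quantity is a difference of powers `sin (u / 2) ^ (2q)`,
and the sine is comparable to its argument. This is the density `t ^ (2q - 1)` in the angular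
variable. -/
theorem le_one_sub_cos_rpow_sub {q t h : ℝ} (hq : 1 / 2 ≤ q) (ht0 : 0 ≤ t)
    (ht : t ≤ Real.pi / 2) (hh0 : 0 ≤ h) (hh : h ≤ 1 / 6) :
    h / 8 * (t / 4) ^ (2 * q - 1) ≤ (1 - Real.cos (t + h)) ^ q - (1 - Real.cos t) ^ q := by
  have hpi := Real.pi_gt_three
  have hpi4 := Real.pi_le_four
  have hpow : ∀ u : ℝ, 0 ≤ u → u ≤ 2 * Real.pi →
      (1 - Real.cos u) ^ q = 2 ^ q * Real.sin (u / 2) ^ (2 * q) := by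
    intro u hu hu'
    have hs : 0 ≤ Real.sin (u / 2) :=
      Real.sin_nonneg_of_nonneg_of_le_pi (by linarith) (by linarith)
    have h1 : 1 - Real.cos u = 2 * Real.sin (u / 2) ^ 2 := by
      have h2 := Real.cos_sq_add_sin_sq (u / 2)
      have h3 : Real.cos u = 2 * Real.cos (u / 2) ^ 2 - 1 := by
        rw [← Real.cos_two_mul]
        ring_nf
      rw [h3]
      linear_combination -2 * h2
    rw [h1, Real.mul_rpow zero_le_two (sq_nonneg _), ← Real.rpow_natCast, ← Real.rpow_mul hs]
    norm_num
  have h0 := le_sin_half_add_sub ht0 ht hh0 hh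
  have hs1 : t / 4 ≤ Real.sin (t / 2) := by
    refine le_trans ?_ (Real.mul_le_sin (x := t / 2) (by linarith) (by linarith))
    have : 1 / 2 ≤ 2 / Real.pi := by
      rw [div_le_div_iff₀ (by norm_num) Real.pi_pos]
      linarith
    nlinarith
  rw [hpow _ (by linarith) (by linarith), hpow _ ht0 (by linarith), ← mul_sub]
  have h1 := mul_rpow_sub_one_le_rpow_sub_rpow (m := 2 * q) (by linarith)
    ((by linarith : 0 ≤ t / 4).trans hs1) (by linarith : Real.sin (t / 2) ≤ Real.sin ((t + h) / 2))
  have h2 : (t / 4) ^ (2 * q - 1) ≤ Real.sin (t / 2) ^ (2 * q - 1) :=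
    Real.rpow_le_rpow (by linarith) hs1 (by linarith)
  have h3 : (1 : ℝ) ≤ 2 ^ q := Real.one_le_rpow one_le_two (by linarith)
  have h4 : 0 ≤ (t / 4) ^ (2 * q - 1) := Real.rpow_nonneg (by linarith) _
  calc h / 8 * (t / 4) ^ (2 * q - 1)
      ≤ (Real.sin ((t + h) / 2) - Real.sin (t / 2)) * Real.sin (t / 2) ^ (2 * q - 1) := by
        gcongr
        linarith
    _ ≤ Real.sin ((t + h) / 2) ^ (2 * q) - Real.sin (t / 2) ^ (2 * q) := h1
    _ ≤ _ := le_mul_of_one_le_left (by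
        refine le_trans (mul_nonneg (by linarith) (h4.trans h2)) h1) h3

/-- The maximum of a polynomial is controlled by its values on a covering set, if it is attained
at `cos t` with `t` at least of order `1 / N`. -/
theorem le_two_mul_of_covers {q c K κ : ℝ} (hq : 1 / 2 ≤ q) (hc : 0 < c) (hK : 0 ≤ K)
    (hcK : 48 < c * (K / 4) ^ (2 * q - 1)) {N : ℕ} (hN : 1 ≤ N) (hκ : c * (N : ℝ) ^ (2 * q) ≤ κ)
    {S : Set ℝ} (hS : Covers q κ S) {p : ℂ[X]} (hp : p.natDegree ≤ N) {A B : ℝ}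
    (hB : ∀ t : ℝ, t ∈ Set.Icc (-1 : ℝ) 1 → ‖p.eval (t : ℂ)‖ ≤ B)
    (hA : ∀ s ∈ S, ‖p.eval (s : ℂ)‖ ≤ A) {t : ℝ} (ht : K / N ≤ t) (ht' : t ≤ Real.pi / 2)
    (hmax : ‖p.eval (Real.cos t : ℂ)‖ = B) : B ≤ 2 * A := by
  have hpi := Real.pi_gt_three
  have hN0 : (0 : ℝ) < N := by exact_mod_cast hN
  have hN1 : (1 : ℝ) ≤ N := by exact_mod_cast hN
  have hB0 : 0 ≤ B := hmax ▸ norm_nonneg _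
  -- With the constant `3 * N` of the Bernstein inequality, moving by `h` changes `p` by at most `B
  -- / 2`.
  set h : ℝ := 1 / (6 * N) with hh
  have hh0 : 0 ≤ h := by positivity
  have hh6 : h ≤ 1 / 6 := by
    rw [hh]
    exact one_div_le_one_div_of_le (by norm_num) (by linarith)
  have ht0 : 0 ≤ t := le_trans (by positivity) ht
  have hmass : 1 < κ * ((1 - Real.cos (t + h)) ^ q - (1 - Real.cos t) ^ q) := by
    have h1 := le_one_sub_cos_rpow_sub hq ht0 ht' hh0 hh6
    have h2 : (K / 4) ^ (2 * q - 1) / (N : ℝ) ^ (2 * q - 1) ≤ (t / 4) ^ (2 * q - 1) := by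
      rw [← Real.div_rpow (by positivity) (by positivity)]
      refine Real.rpow_le_rpow (by positivity) ?_ (by linarith)
      rw [div_right_comm]
      linarith
    have h3 : (N : ℝ) ^ (2 * q) = N ^ (2 * q - 1) * N := by
      rw [Real.rpow_sub_one hN0.ne']
      field_simp
    have h4 : (0 : ℝ) < (N : ℝ) ^ (2 * q - 1) := by positivity
    -- The threshold `48` is the `6` in `h` times the `8` in `le_one_sub_cos_rpow_sub`.
    calc (1 : ℝ) < c * (K / 4) ^ (2 * q - 1) / 48 := by linarith
      _ = c * (N : ℝ) ^ (2 * q) * (h / 8 * ((K / 4) ^ (2 * q - 1) / (N : ℝ) ^ (2 * q - 1))) := by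
        rw [h3, hh]
        field_simp
        ring
      _ ≤ c * (N : ℝ) ^ (2 * q) * ((1 - Real.cos (t + h)) ^ q - (1 - Real.cos t) ^ q) := by
        gcongr
        refine le_trans ?_ h1
        gcongr
      _ ≤ _ := by
        gcongr
        refine le_trans ?_ h1
        positivity
  -- Here `t + h ≤ 2π / 3`, so the arc stays in the range `[-1/2, 1]` of `Covers`.
  obtain ⟨s, hs, hs1, hs2⟩ := hS _ _ (by
      have : Real.cos (2 * Real.pi / 3) = -1 / 2 := by
        rw [show 2 * Real.pi / 3 = Real.pi - Real.pi / 3 by ring, Real.cos_pi_sub,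
          Real.cos_pi_div_three]
        norm_num
      rw [← this]
      exact Real.cos_le_cos_of_nonneg_of_le_pi (by linarith) (by linarith) (by linarith))
    (Real.cos_le_cos_of_nonneg_of_le_pi ht0 (by linarith) (by linarith)) (Real.cos_le_one t) hmass
  have hs3 : t ≤ Real.arccos s := by
    have := Real.arccos_le_arccos hs2
    rwa [Real.arccos_cos ht0 (by linarith)] at this
  have hs4 : Real.arccos s ≤ t + h := by
    have := Real.arccos_le_arccos hs1
    rwa [Real.arccos_cos (by linarith) (by linarith)] at this
  have hcos : Real.cos (Real.arccos s) = s :=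
    Real.cos_arccos (by linarith [Real.neg_one_le_cos (t + h)]) (by linarith [Real.cos_le_one t])
  have h5 := norm_eval_cos_sub_le hp hN hB (Real.arccos s) t
  rw [hcos, abs_of_nonpos (by linarith)] at h5
  have h6 : 3 * N * B * -(t - Real.arccos s) ≤ B / 2 := by
    calc 3 * N * B * -(t - Real.arccos s) ≤ 3 * N * B * h := by
          gcongr
          linarith
      _ = B / 2 := by
          rw [hh]
          field_simp
          ring
  have h7 := norm_sub_norm_le (p.eval (Real.cos t : ℂ)) (p.eval (s : ℂ))
  have h8 := hA s hs
  linarith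

/-! ### Covering sets near the endpoint -/

/-- The points `(2 m / c)^(1 / q)`, between consecutive ones of which `c x^q` increases by two. -/
noncomputable def edgePoint (q c : ℝ) (m : ℕ) : ℝ := (2 * m / c) ^ (1 / q)

theorem edgePoint_nonneg {q c : ℝ} (hc : 0 < c) (m : ℕ) : 0 ≤ edgePoint q c m :=
  Real.rpow_nonneg (by positivity) _

theorem edgePoint_rpow {q c : ℝ} (hq : 0 < q) (hc : 0 < c) (m : ℕ) :
    edgePoint q c m ^ q = 2 * m / c := by
  rw [edgePoint, ← Real.rpow_mul (by positivity), one_div_mul_cancel hq.ne', Real.rpow_one]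

theorem strictMono_edgePoint {q c : ℝ} (hq : 0 < q) (hc : 0 < c) :
    StrictMono (edgePoint q c) := by
  intro m n hmn
  refine Real.rpow_lt_rpow (by positivity) ?_ (by positivity)
  have : (m : ℝ) < n := by exact_mod_cast hmn
  gcongr

theorem tendsto_edgePoint {q c : ℝ} (hq : 0 < q) (hc : 0 < c) :
    Tendsto (edgePoint q c) atTop atTop := by
  refine (tendsto_rpow_atTop (one_div_pos.2 hq)).comp ?_
  exact (tendsto_natCast_atTop_atTop.const_mul_atTop two_pos).atTop_div_const hc

/-- `√(edgePoint q c (2 * n))` is of order `n ^ (1 / (2q))`, which is `o(n)` because `q > 1/2`;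
hence `2⁻ⁿ` beats the growth of the polynomial. -/
theorem exists_edge_degree {q c : ℝ} (hq : 1 / 2 < q) (hc : 0 < c) (E : ℝ) :
    ∃ n : ℕ, 1 ≤ n ∧ E ≤ edgePoint q c (2 * n) ∧
      (1 / 2) ^ n * Real.exp (2 * √(10 * edgePoint q c (2 * n))) ≤ 1 / 2 := by
  have hq0 : 0 < q := by linarith
  have hlog : 0 < Real.log 2 := Real.log_pos one_lt_two
  have h1 : ∀ᶠ n : ℕ in atTop, E ≤ edgePoint q c (2 * n) :=
    ((tendsto_edgePoint hq0 hc).comp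
      (tendsto_id.const_mul_atTop' two_pos)).eventually_ge_atTop E
  have hlo : (fun n : ℕ => 2 * √(10 * edgePoint q c (2 * n))) =o[atTop] fun n : ℕ => (n : ℝ) := by
    have h2 : (fun y : ℝ => y ^ (1 / (2 * q))) =o[atTop] fun y : ℝ => y := by
      have hexp : 0 < 1 - 1 / (2 * q) := by
        rw [sub_pos, div_lt_one (by positivity)]
        linarith
      refine (Asymptotics.isLittleO_iff_tendsto' ?_).2
        ((tendsto_rpow_neg_atTop hexp).congr' ?_)
      · filter_upwards [eventually_gt_atTop 0] with y hy h0
        exact absurd h0 hy.ne'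
      · filter_upwards [eventually_gt_atTop 0] with y hy
        rw [neg_sub, Real.rpow_sub_one hy.ne']
    have h3 := (h2.comp_tendsto (tendsto_natCast_atTop_atTop (R := ℝ))).const_mul_left
      (2 * √10 * (4 / c) ^ (1 / (2 * q)))
    refine h3.congr_left fun n => ?_
    have h4 : √(edgePoint q c (2 * n)) = (4 / c) ^ (1 / (2 * q)) * (n : ℝ) ^ (1 / (2 * q)) := by
      rw [edgePoint, Real.sqrt_eq_rpow, ← Real.rpow_mul (by positivity),
        ← Real.mul_rpow (by positivity) (by positivity)]
      congr 1
      · push_cast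
        ring
      · field_simp
    rw [Real.sqrt_mul (by norm_num), h4]
    simp only [Function.comp_apply]
    ring
  have h2 := hlo.bound (half_pos hlog)
  obtain ⟨n, hn1, hn2, hn3⟩ := (h1.and (h2.and (eventually_ge_atTop 2))).exists
  refine ⟨n, by omega, hn1, ?_⟩
  rw [Real.norm_of_nonneg (by positivity), Real.norm_of_nonneg (by positivity)] at hn2
  have hn : (2 : ℝ) ≤ n := by exact_mod_cast hn3
  have h5 : ((1 : ℝ) / 2) ^ n = Real.exp (-(n * Real.log 2)) := by
    rw [Real.exp_neg, Real.exp_nat_mul, Real.exp_log two_pos, one_div, inv_pow]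
  have h6 : (1 : ℝ) / 2 = Real.exp (-Real.log 2) := by
    rw [Real.exp_neg, Real.exp_log two_pos, one_div]
  rw [h5, ← Real.exp_add, h6, Real.exp_le_exp]
  nlinarith

/-- The maximum of a polynomial is controlled by its values on a covering set, if it is attained
at distance at most `E / N²` from the endpoint `1`. -/
theorem exists_le_mul_of_covers_edge {q c : ℝ} (hq : 1 / 2 < q) (hc : 0 < c) (E : ℝ) :
    ∃ (C : ℝ) (N₀ : ℕ), ∀ N : ℕ, N₀ ≤ N → 1 ≤ N → ∀ κ : ℝ, c * (N : ℝ) ^ (2 * q) ≤ κ →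
      ∀ S : Set ℝ, Covers q κ S → ∀ p : ℂ[X], p.natDegree ≤ N → ∀ A B : ℝ, 0 ≤ A →
      (∀ t : ℝ, t ∈ Set.Icc (-1 : ℝ) 1 → ‖p.eval (t : ℂ)‖ ≤ B) →
      (∀ s ∈ S, ‖p.eval (s : ℂ)‖ ≤ A) → ∀ y : ℝ, 1 - E / (N : ℝ) ^ 2 ≤ y → y ≤ 1 →
      ‖p.eval (y : ℂ)‖ = B → B ≤ C * A := by
  have hq0 : 0 < q := by linarith
  obtain ⟨n, hn1, hnE, hn⟩ := exists_edge_degree hq hc E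
  set b := edgePoint q c with hb
  have hbm : StrictMono b := strictMono_edgePoint hq0 hc
  have hb0 : ∀ m, 0 ≤ b m := edgePoint_nonneg hc
  obtain ⟨δ, hδ, hδb⟩ : ∃ δ > 0, ∀ k : Fin n, δ ≤ b (2 * k + 2) - b (2 * k + 1) := by
    have : Nonempty (Fin n) := ⟨⟨0, hn1⟩⟩
    obtain ⟨k₀, hk₀⟩ := Finite.exists_min fun k : Fin n => b (2 * k + 2) - b (2 * k + 1)
    exact ⟨_, sub_pos.2 (hbm (by omega)), hk₀⟩
  obtain ⟨N₀, hN₀⟩ := exists_nat_ge (b (2 * n))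
  -- The inner `2` comes from the interpolation estimate, the outer one from absorbing the remainder
  -- `B / 2`.
  refine ⟨2 * (2 * (n * (6 * b (2 * n) / δ) ^ (n - 1))), N₀, ?_⟩
  intro N hNN hN κ hκ S hS p hp A B hA0 hB hA y hy hy1 hmax
  have hN1 : (1 : ℝ) ≤ N := by exact_mod_cast hN
  have hNsq : b (2 * n) ≤ (N : ℝ) ^ 2 := by
    have : (N₀ : ℝ) ≤ N := by exact_mod_cast hNN
    nlinarith
  have hNpos : (0 : ℝ) < (N : ℝ) ^ 2 := by positivity
  have hB0 : 0 ≤ B := hmax ▸ norm_nonneg _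
  -- One node is taken from every other window between scaled edge points; the skipped windows keep
  -- the chosen nodes at least `δ / N²` apart. The increase of two per window gives the strict
  -- inequality that `Covers` asks for.
  have hnode : ∀ k : Fin n, ∃ s ∈ S, 1 - b (2 * k + 1) / (N : ℝ) ^ 2 ≤ s ∧
      s ≤ 1 - b (2 * k) / (N : ℝ) ^ 2 := by
    intro k
    have hk : b (2 * k + 1) ≤ b (2 * n) := hbm.monotone (by omega)
    refine hS _ _ ?_ ?_ ?_ ?_
    · have : b (2 * k + 1) / (N : ℝ) ^ 2 ≤ 1 := (div_le_one hNpos).2 (hk.trans hNsq)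
      linarith
    · have : b (2 * k) ≤ b (2 * k + 1) := hbm.monotone (by omega)
      gcongr
    · have := hb0 (2 * k)
      have : 0 ≤ b (2 * k) / (N : ℝ) ^ 2 := by positivity
      linarith
    · have h1 : ((N : ℝ) ^ 2) ^ q = (N : ℝ) ^ (2 * q) := by
        rw [← Real.rpow_natCast, ← Real.rpow_mul (by positivity)]
        norm_num
      rw [sub_sub_cancel, sub_sub_cancel, Real.div_rpow (hb0 _) hNpos.le,
        Real.div_rpow (hb0 _) hNpos.le, h1, hb, edgePoint_rpow hq0 hc, edgePoint_rpow hq0 hc]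
      have h2 : (0 : ℝ) < (N : ℝ) ^ (2 * q) := by positivity
      have h3 : 2 * ((2 * (k : ℕ) + 1 : ℕ) : ℝ) / c / (N : ℝ) ^ (2 * q) -
          2 * ((2 * (k : ℕ) : ℕ) : ℝ) / c / (N : ℝ) ^ (2 * q) = 2 / (c * (N : ℝ) ^ (2 * q)) := by
        push_cast
        field_simp
        ring
      rw [h3, ← mul_div_assoc, lt_div_iff₀ (by positivity)]
      have : 0 < c * (N : ℝ) ^ (2 * q) := by positivity
      linarith
  choose s hsS hs1 hs2 using hnode
  set r := b (2 * n) / (N : ℝ) ^ 2 with hr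
  have hbn : 0 < b (2 * n) := (hb0 0).trans_lt (hbm (by omega))
  have hr0 : 0 < r := by positivity
  have hlt : ∀ i j : Fin n, i < j → δ / (N : ℝ) ^ 2 ≤ s i - s j := by
    intro i j hij
    have h1 : b (2 * i + 2) ≤ b (2 * j) := hbm.monotone (by
      have : (i : ℕ) < j := hij
      omega)
    calc δ / (N : ℝ) ^ 2 ≤ (b (2 * j) - b (2 * i + 1)) / (N : ℝ) ^ 2 := by
          gcongr
          linarith [hδb i]
      _ ≤ s i - s j := by
          rw [sub_div]
          linarith [hs1 i, hs2 j]
  have hsep : ∀ i j : Fin n, i ≠ j → δ / (N : ℝ) ^ 2 ≤ ‖(s i : ℂ) - (s j : ℂ)‖ := by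
    intro i j hij
    rw [← Complex.ofReal_sub, Complex.norm_real, Real.norm_eq_abs]
    rcases lt_or_gt_of_ne hij with h | h
    · exact (hlt i j h).trans (le_abs_self _)
    · rw [abs_sub_comm]
      exact (hlt j i h).trans (le_abs_self _)
  have hdisc : ∀ u : ℝ, 1 - r ≤ u → u ≤ 1 → ‖(u : ℂ) - 1‖ ≤ r := by
    intro u hu hu1
    rw [← Complex.ofReal_one, ← Complex.ofReal_sub, Complex.norm_real, Real.norm_eq_abs,
      abs_of_nonpos (by linarith)]
    linarith
  have hsv : ∀ i, ‖(s i : ℂ) - 1‖ ≤ r := by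
    intro i
    refine hdisc _ (le_trans ?_ (hs1 i)) ((hs2 i).trans ?_)
    · have : b (2 * i + 1) ≤ b (2 * n) := hbm.monotone (by omega)
      rw [hr]
      gcongr
    · have := hb0 (2 * i)
      have : 0 ≤ b (2 * i) / (N : ℝ) ^ 2 := by positivity
      linarith
  have hyr : ‖(y : ℂ) - 1‖ ≤ r := by
    refine hdisc y (le_trans ?_ hy) hy1
    rw [hr]
    gcongr
  have hgrow : ∀ z : ℂ, ‖z - 1‖ = 5 * r →
      ‖p.eval z‖ ≤ Real.exp (2 * √(10 * b (2 * n))) * B := by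
    intro z hz
    refine (norm_eval_le_of_mem_closedBall_one hp hB hz.le).trans (le_of_eq ?_)
    have : N * (2 * √(2 * (5 * r))) = 2 * √(10 * b (2 * n)) := by
      have h1 : 2 * (5 * r) = 10 * b (2 * n) / (N : ℝ) ^ 2 := by
        rw [hr]
        ring
      rw [h1, Real.sqrt_div' _ hNpos.le, Real.sqrt_sq (by positivity)]
      field_simp
    rw [this]
  have key := norm_eval_le_of_separated_of_growth (by positivity) hr0 hsep hsv
    (fun i => hA _ (hsS i)) hA0 hgrow hyr
  have hrd : 6 * r / (δ / (N : ℝ) ^ 2) = 6 * b (2 * n) / δ := by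
    rw [hr]
    field_simp
  rw [hmax, hrd, ← mul_assoc] at key
  have : (1 / 2) ^ n * Real.exp (2 * √(10 * b (2 * n))) * B ≤ 1 / 2 * B := by gcongr
  linarith

/-! ### Norming inequality for covering sets -/

/-- One-sided norming inequality, for large oversampling. -/
theorem exists_le_mul_of_covers {q c : ℝ} (hq : 1 / 2 ≤ q) (hc : 0 < c)
    (hqc : 1 / 2 < q ∨ 48 < c) :
    ∃ (C : ℝ) (N₀ : ℕ), 0 ≤ C ∧ ∀ N : ℕ, N₀ ≤ N → 1 ≤ N → ∀ κ : ℝ, c * (N : ℝ) ^ (2 * q) ≤ κ →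
      ∀ S : Set ℝ, Covers q κ S → ∀ p : ℂ[X], p.natDegree ≤ N → ∀ A B : ℝ, 0 ≤ A →
      (∀ t : ℝ, t ∈ Set.Icc (-1 : ℝ) 1 → ‖p.eval (t : ℂ)‖ ≤ B) →
      (∀ s ∈ S, ‖p.eval (s : ℂ)‖ ≤ A) → ∀ y : ℝ, 0 ≤ y → y ≤ 1 →
      ‖p.eval (y : ℂ)‖ = B → B ≤ C * A := by
  rcases hq.eq_or_lt with h | h
  · refine ⟨2, 0, zero_le_two, ?_⟩
    intro N _ hN κ hκ S hS p hp A B hA0 hB hA y hy0 hy1 hmax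
    have hcos := Real.cos_arccos (by linarith) hy1
    -- For `q = 1/2` the exponent `2 * q - 1` vanishes and `0 ^ 0 = 1`, so `K = 0` is admissible as
    -- soon as `48 < c`.
    refine le_two_mul_of_covers hq hc le_rfl ?_ hN hκ hS hp hB hA
      (t := Real.arccos y) ?_ ?_ (by rwa [hcos])
    · rw [← h]
      rcases hqc with h' | h'
      · linarith
      · norm_num
        exact h'
    · rw [zero_div]
      exact Real.arccos_nonneg y
    · exact Real.arccos_le_pi_div_two.2 hy0
  · obtain ⟨K, hK0, hK⟩ : ∃ K : ℝ, 0 ≤ K ∧ 48 < c * (K / 4) ^ (2 * q - 1) := by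
      have h1 : Tendsto (fun K : ℝ => c * (K / 4) ^ (2 * q - 1)) atTop atTop :=
        ((tendsto_rpow_atTop (by linarith)).comp
          (tendsto_id.atTop_div_const (by norm_num))).const_mul_atTop hc
      obtain ⟨K, h2, h3⟩ := ((eventually_ge_atTop 0).and (h1.eventually_gt_atTop 48)).exists
      exact ⟨K, h2, h3⟩
    -- `K ^ 2 / 2` is due to `1 - cos t ≤ t ^ 2 / 2` for `t ≤ K / N`.
    obtain ⟨C, N₀, hC⟩ := exists_le_mul_of_covers_edge h hc (K ^ 2 / 2)
    refine ⟨max C 2, N₀, le_max_of_le_right zero_le_two, ?_⟩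
    intro N hNN hN κ hκ S hS p hp A B hA0 hB hA y hy0 hy1 hmax
    have hcos := Real.cos_arccos (by linarith) hy1
    rcases le_total (K / N) (Real.arccos y) with h4 | h4
    · refine (le_two_mul_of_covers hq hc hK0 hK hN hκ hS hp hB hA h4
        (Real.arccos_le_pi_div_two.2 hy0) (by rwa [hcos])).trans ?_
      gcongr
      exact le_max_right _ _
    · refine (hC N hNN hN κ hκ S hS p hp A B hA0 hB hA y ?_ hy1 hmax).trans ?_
      · have h5 := Real.one_sub_sq_div_two_le_cos (x := Real.arccos y)
        rw [hcos] at h5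
        refine le_trans ?_ h5
        have h6 : Real.arccos y ^ 2 ≤ (K / N) ^ 2 := by
          have := Real.arccos_nonneg y
          gcongr
        rw [div_pow] at h6
        rw [div_right_comm]
        linarith
      · gcongr
        exact le_max_left _ _

/-- Two-sided norming inequality, for large degree. -/
theorem exists_norm_eval_le_of_covers {q c : ℝ} (hq : 1 / 2 ≤ q) (hc : 0 < c)
    (hqc : 1 / 2 < q ∨ 48 < c) :
    ∃ (C : ℝ) (N₀ : ℕ), 0 ≤ C ∧ ∀ N : ℕ, N₀ ≤ N → 1 ≤ N → ∀ κ : ℝ, c * (N : ℝ) ^ (2 * q) ≤ κ →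
      ∀ S : Set ℝ, Covers q κ S → Covers q κ (-S) → ∀ p : ℂ[X], p.natDegree ≤ N →
      ∀ A : ℝ, 0 ≤ A → (∀ s ∈ S, ‖p.eval (s : ℂ)‖ ≤ A) →
      ∀ t : ℝ, t ∈ Set.Icc (-1 : ℝ) 1 → ‖p.eval (t : ℂ)‖ ≤ C * A := by
  obtain ⟨C, N₀, hC0, hC⟩ := exists_le_mul_of_covers hq hc hqc
  refine ⟨C, N₀, hC0, ?_⟩
  intro N hNN hN κ hκ S hS hS' p hp A hA0 hA t ht
  obtain ⟨y, hy, hmax⟩ := isCompact_Icc.exists_isMaxOn (s := Set.Icc (-1 : ℝ) 1)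
    ⟨0, by simp⟩ (f := fun u : ℝ => ‖p.eval (u : ℂ)‖) (by fun_prop)
  refine (hmax ht).trans ?_
  rcases le_total 0 y with h | h
  · exact hC N hNN hN κ hκ S hS p hp A _ hA0 (fun u hu => hmax hu) hA y h hy.2 rfl
  · refine hC N hNN hN κ hκ (-S) hS' (p.comp (-X)) ?_ A _ hA0 ?_ ?_ (-y) (by linarith)
      (by linarith [hy.1]) (by simp)
    · rw [natDegree_comp, natDegree_neg, natDegree_X, mul_one]
      exact hp
    · intro u hu
      have := hmax (show -u ∈ Set.Icc (-1 : ℝ) 1 from ⟨by linarith [hu.2], by linarith [hu.1]⟩)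
      simpa using this
    · intro s hs
      simpa using hA (-s) hs

/-! ### Mass estimates for modified Jacobi weights -/

section Weight

variable {g : ℝ → ℝ} {α β lo hi : ℝ}

/-- Reflection exchanges the exponents, so that only the endpoint `1` needs estimates. -/
theorem IsModifiedJacobi.comp_neg (h : IsModifiedJacobi g α β lo hi) :
    IsModifiedJacobi (fun x => g (-x)) β α lo hi := by
  have hmp := (Measure.measurePreserving_neg (volume : Measure ℝ)).restrict_preimage
    (measurableSet_Ioo (a := (-1 : ℝ)) (b := 1))
  have hpre : (Neg.neg ⁻¹' Set.Ioo (-1 : ℝ) 1) = Set.Ioo (-1 : ℝ) 1 := by simp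
  rw [hpre] at hmp
  refine ⟨h.meas.comp_quasiMeasurePreserving hmp.quasiMeasurePreserving,
    hmp.quasiMeasurePreserving.ae h.bounds, ?_⟩
  have h1 := intervalIntegral.integral_comp_neg (a := -1) (b := 1) (jacobiWeight g α β)
  rw [neg_neg, h.normalized] at h1
  refine Eq.trans (intervalIntegral.integral_congr fun x _ => ?_) h1
  simp only [jacobiWeight, sub_neg_eq_add, ← sub_eq_add_neg]
  ring

theorem IsModifiedJacobi.intervalIntegrable (h : IsModifiedJacobi g α β lo hi) {a b : ℝ}
    (ha : a ∈ Set.Icc (-1 : ℝ) 1) (hb : b ∈ Set.Icc (-1 : ℝ) 1) :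
    IntervalIntegrable (jacobiWeight g α β) volume a b := by
  have h1 : IntervalIntegrable (jacobiWeight g α β) volume (-1) 1 := by
    -- A non-integrable function would have integral `0` by convention, contradicting the
    -- normalisation.
    by_contra hn
    have := h.normalized
    rw [intervalIntegral.integral_undef hn] at this
    exact zero_ne_one this
  refine h1.mono_set ?_
  rw [Set.uIcc_of_le (by norm_num : (-1 : ℝ) ≤ 1)]
  exact Set.uIcc_subset_Icc ha hb

theorem IsModifiedJacobi.ae_bounds (h : IsModifiedJacobi g α β lo hi) {a b : ℝ}
    (ha : -1 ≤ a) (hb : b ≤ 1) :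
    ∀ᵐ x ∂(volume.restrict (Set.Icc a b)), x ∈ Set.Ioo (-1 : ℝ) 1 ∧ x ∈ Set.Icc a b ∧
      lo ≤ g x ∧ g x ≤ hi := by
  have h1 : ∀ᵐ x ∂(volume.restrict (Set.Icc (-1 : ℝ) 1)), x ∈ Set.Ioo (-1 : ℝ) 1 ∧
      lo ≤ g x ∧ g x ≤ hi := by
    rw [← Measure.restrict_congr_set Ioo_ae_eq_Icc]
    filter_upwards [h.bounds, ae_restrict_mem measurableSet_Ioo] with x hx hx'
    exact ⟨hx', hx⟩
  filter_upwards [ae_restrict_of_ae_restrict_of_subset (Set.Icc_subset_Icc ha hb) h1,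
    ae_restrict_mem measurableSet_Icc] with x hx hx'
  exact ⟨hx.1, hx', hx.2⟩

theorem IsModifiedJacobi.integral_nonneg (h : IsModifiedJacobi g α β lo hi) (hlo : 0 < lo)
    {a b : ℝ} (ha : -1 ≤ a) (hab : a ≤ b) (hb : b ≤ 1) :
    0 ≤ ∫ x in a..b, jacobiWeight g α β x := by
  refine intervalIntegral.integral_nonneg_of_ae_restrict hab ?_
  filter_upwards [h.ae_bounds ha hb] with x hx
  have h1 : 0 ≤ 1 - x := by linarith [hx.1.2]
  have h2 : 0 ≤ 1 + x := by linarith [hx.1.1]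
  have h3 : 0 ≤ g x := by linarith [hx.2.2.1]
  exact mul_nonneg (mul_nonneg h3 (Real.rpow_nonneg h1 _)) (Real.rpow_nonneg h2 _)

theorem rpow_neg_abs_le_rpow {y s : ℝ} (hy : 1 / 2 ≤ y) (hy2 : y ≤ 2) :
    (2 : ℝ) ^ (-|s|) ≤ y ^ s := by
  rcases le_total 0 s with hs | hs
  · rw [abs_of_nonneg hs, Real.rpow_neg zero_le_two, ← Real.inv_rpow zero_le_two]
    exact Real.rpow_le_rpow (by norm_num) (by linarith) hs
  · rw [abs_of_nonpos hs, neg_neg]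
    exact Real.rpow_le_rpow_of_nonpos (by linarith) hy2 hs

theorem rpow_le_rpow_abs {y s : ℝ} (hy : 1 ≤ y) (hy2 : y ≤ 2) : y ^ s ≤ (2 : ℝ) ^ |s| :=
  (Real.rpow_le_rpow_of_exponent_le hy (le_abs_self s)).trans
    (Real.rpow_le_rpow (by linarith) hy2 (abs_nonneg s))

theorem intervalIntegrable_one_sub_rpow {γ : ℝ} (hγ : -1 < γ) (a b : ℝ) :
    IntervalIntegrable (fun x : ℝ => (1 - x) ^ γ) volume a b := by
  have := (intervalIntegral.intervalIntegrable_rpow' hγ (a := 1 - a) (b := 1 - b)).comp_sub_left 1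
  simpa using this

theorem intervalIntegrable_one_add_rpow {γ : ℝ} (hγ : -1 < γ) (a b : ℝ) :
    IntervalIntegrable (fun x : ℝ => (1 + x) ^ γ) volume a b := by
  have := (intervalIntegral.intervalIntegrable_rpow' hγ (a := 1 + a) (b := 1 + b)).comp_add_left 1
  simpa using this

/-- Lower bound for the mass of an interval in terms of the distances to the endpoint `1`. -/
theorem IsModifiedJacobi.le_integral (h : IsModifiedJacobi g α β lo hi) (hlo : 0 < lo)
    {γ : ℝ} (hγ : -1 < γ) (hαγ : α ≤ γ) {a b : ℝ} (ha : -1 / 2 ≤ a) (hab : a ≤ b) (hb : b ≤ 1) :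
    lo * (2 ^ (α - γ) * 2 ^ (-|β|)) * (((1 - a) ^ (γ + 1) - (1 - b) ^ (γ + 1)) / (γ + 1)) ≤
      ∫ x in a..b, jacobiWeight g α β x := by
  have h1 : ((1 - a) ^ (γ + 1) - (1 - b) ^ (γ + 1)) / (γ + 1) = ∫ x in a..b, (1 - x) ^ γ := by
    rw [intervalIntegral.integral_comp_sub_left (fun x => x ^ γ) 1, integral_rpow (Or.inl hγ)]
  rw [h1, ← intervalIntegral.integral_const_mul]
  refine intervalIntegral.integral_mono_ae_restrict hab
    ((intervalIntegrable_one_sub_rpow hγ a b).const_mul _)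
    (h.intervalIntegrable ⟨by linarith, by linarith⟩ ⟨by linarith, hb⟩) ?_
  filter_upwards [h.ae_bounds (by linarith) hb] with x hx
  have hx1 : 0 < 1 - x := by linarith [hx.1.2]
  have hx2 : 1 - x ≤ 2 := by linarith [hx.2.1.1]
  have e1 : (1 - x) ^ α = (1 - x) ^ γ * (1 - x) ^ (α - γ) := by
    rw [← Real.rpow_add hx1]
    ring_nf
  have e2 : (2 : ℝ) ^ (α - γ) ≤ (1 - x) ^ (α - γ) :=
    Real.rpow_le_rpow_of_nonpos hx1 hx2 (by linarith)
  have e3 : (2 : ℝ) ^ (-|β|) ≤ (1 + x) ^ β :=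
    rpow_neg_abs_le_rpow (by linarith [hx.2.1.1]) (by linarith [hx.1.2])
  have hg : 0 ≤ g x := hlo.le.trans hx.2.2.1
  simp only [jacobiWeight]
  rw [e1]
  calc lo * (2 ^ (α - γ) * 2 ^ (-|β|)) * (1 - x) ^ γ
      ≤ g x * ((1 - x) ^ (α - γ) * (1 + x) ^ β) * (1 - x) ^ γ := by
        gcongr
        exact hx.2.2.1
    _ = _ := by ring

/-- The majorant does not depend on `g`, which makes the separation of nodes uniform in `g`. -/
theorem IsModifiedJacobi.integral_le (h : IsModifiedJacobi g α β lo hi) (hlo : 0 < lo)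
    (hα : -1 < α) (hβ : -1 < β) {a b : ℝ} (ha : -1 ≤ a) (hab : a ≤ b) (hb : b ≤ 1) :
    ∫ x in a..b, jacobiWeight g α β x ≤
      |hi| * ∫ x in a..b, (2 ^ |β| * (1 - x) ^ α + 2 ^ |α| * (1 + x) ^ β) := by
  rw [← intervalIntegral.integral_const_mul]
  refine intervalIntegral.integral_mono_ae_restrict hab
    (h.intervalIntegrable ⟨ha, by linarith⟩ ⟨by linarith, hb⟩)
    ((((intervalIntegrable_one_sub_rpow hα a b).const_mul _).add
      ((intervalIntegrable_one_add_rpow hβ a b).const_mul _)).const_mul _) ?_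
  filter_upwards [h.ae_bounds ha hb] with x hx
  have hx1 : 0 < 1 - x := by linarith [hx.1.2]
  have hx2 : 0 < 1 + x := by linarith [hx.1.1]
  have hg : 0 ≤ g x := hlo.le.trans hx.2.2.1
  have e1 : 0 ≤ (1 - x) ^ α := Real.rpow_nonneg hx1.le _
  have e2 : 0 ≤ (1 + x) ^ β := Real.rpow_nonneg hx2.le _
  have e3 : 0 ≤ 2 ^ |β| * (1 - x) ^ α := by positivity
  have e4 : 0 ≤ 2 ^ |α| * (1 + x) ^ β := by positivity
  simp only [jacobiWeight]
  rw [mul_assoc]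
  refine mul_le_mul (hx.2.2.2.trans (le_abs_self hi)) ?_ (by positivity) (abs_nonneg _)
  rcases le_total 0 x with h0 | h0
  · have := rpow_le_rpow_abs (y := 1 + x) (s := β) (by linarith) (by linarith)
    nlinarith
  · have := rpow_le_rpow_abs (y := 1 - x) (s := α) (by linarith) (by linarith)
    nlinarith

variable {M : ℕ} {x : Fin (M + 1) → I}

/-- An interval whose mass exceeds `1 / M` contains a node. -/
theorem IsModifiedJacobi.exists_node_mem (h : IsModifiedJacobi g α β lo hi) (hlo : 0 < lo)
    (hM : 1 ≤ M) (hx : Equidistributed (jacobiWeight g α β) x) {a b : ℝ}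
    (ha : -1 ≤ a) (hab : a ≤ b) (hb : b ≤ 1)
    (hmass : 1 / (M : ℝ) < ∫ t in a..b, jacobiWeight g α β t) :
    ∃ m, a ≤ (x m : ℝ) ∧ (x m : ℝ) ≤ b := by
  have hM0 : (0 : ℝ) < M := by exact_mod_cast hM
  set w := jacobiWeight g α β
  set G : ℝ → ℝ := fun y => ∫ t in (-1 : ℝ)..y, w t with hG
  have hint : ∀ u v : ℝ, u ∈ Set.Icc (-1 : ℝ) 1 → v ∈ Set.Icc (-1 : ℝ) 1 →
      G v = G u + ∫ t in u..v, w t := fun u v hu hv =>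
    (intervalIntegral.integral_add_adjacent_intervals
      (h.intervalIntegrable ⟨le_rfl, by norm_num⟩ hu) (h.intervalIntegrable hu hv)).symm
  have hmono : ∀ u v : ℝ, -1 ≤ u → u ≤ v → v ≤ 1 → G u ≤ G v := by
    intro u v hu huv hv
    rw [hint u v ⟨hu, huv.trans hv⟩ ⟨hu.trans huv, hv⟩]
    linarith [h.integral_nonneg hlo hu huv hv]
  have hGa : 0 ≤ G a := h.integral_nonneg hlo le_rfl ha (hab.trans hb)
  have hGb : G b ≤ 1 := by
    have := hmono b 1 (ha.trans hab) hb le_rfl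
    rwa [show G 1 = 1 from h.normalized] at this
  have hGab : G a + 1 / M < G b := by
    rw [hint a b ⟨ha, hab.trans hb⟩ ⟨ha.trans hab, hb⟩]
    linarith
  -- The least integer above `M * G a`; it lies below `M * G b` because the mass exceeds `1 / M`.
  set k := ⌊M * G a⌋₊ + 1 with hk
  have hk1 : M * G a < k := by
    rw [hk]
    push_cast
    exact Nat.lt_floor_add_one _
  have hk2 : (k : ℝ) < M * G b := by
    have h1 : (⌊M * G a⌋₊ : ℝ) ≤ M * G a := Nat.floor_le (by positivity)
    have h2 : (M : ℝ) * (G a + 1 / M) < M * G b := by gcongr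
    have h3 : (M : ℝ) * (G a + 1 / M) = M * G a + 1 := by field_simp
    rw [hk]
    push_cast
    linarith
  have hkM : k < M + 1 := by
    have h1 : (M : ℝ) * G b ≤ M := mul_le_of_le_one_right hM0.le hGb
    have h2 : (k : ℝ) < M := hk2.trans_le h1
    have h3 : k < M := by exact_mod_cast h2
    omega
  have hxk : (k : ℝ) / M = G (x ⟨k, hkM⟩) := hx ⟨k, hkM⟩
  refine ⟨⟨k, hkM⟩, ?_, ?_⟩
  · by_contra! hlt
    have h1 := hmono _ _ (x ⟨k, hkM⟩).2.1 hlt.le (hab.trans hb)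
    rw [← hxk, div_le_iff₀ hM0] at h1
    linarith
  · by_contra! hlt
    have h1 := hmono _ _ (ha.trans hab) hlt.le (x ⟨k, hkM⟩).2.2
    rw [← hxk, le_div_iff₀ hM0] at h1
    linarith

/-- The constant in the covering property of equidistributed nodes. -/
noncomputable def coverConst (α β lo γ : ℝ) : ℝ :=
  lo * (2 ^ (α - γ) * 2 ^ (-|β|)) * (2 ^ (β - γ) * 2 ^ (-|α|)) / (γ + 1)

theorem coverConst_pos {γ : ℝ} (hlo : 0 < lo) (hγ : -1 < γ) : 0 < coverConst α β lo γ := by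
  have : 0 < γ + 1 := by linarith
  rw [coverConst]
  positivity

/-- The symmetry, bought with an extra factor at most `1`, lets one constant serve both endpoints.
-/
theorem coverConst_comm {γ : ℝ} : coverConst α β lo γ = coverConst β α lo γ := by
  simp only [coverConst]
  ring

theorem IsModifiedJacobi.lt_integral (h : IsModifiedJacobi g α β lo hi) (hlo : 0 < lo)
    {γ : ℝ} (hγ : -1 < γ) (hαγ : α ≤ γ) (hβγ : β ≤ γ) (hM : 1 ≤ M) {a b : ℝ}
    (ha : -1 / 2 ≤ a) (hab : a ≤ b) (hb : b ≤ 1)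
    (hmass : 1 < coverConst α β lo γ * M * ((1 - a) ^ (γ + 1) - (1 - b) ^ (γ + 1))) :
    1 / (M : ℝ) < ∫ t in a..b, jacobiWeight g α β t := by
  have hM0 : (0 : ℝ) < M := by exact_mod_cast hM
  have hγ1 : 0 < γ + 1 := by linarith
  refine lt_of_lt_of_le ?_ (h.le_integral hlo hγ hαγ ha hab hb)
  rw [div_lt_iff₀ hM0]
  refine hmass.trans_le ?_
  have h1 : (2 : ℝ) ^ (β - γ) * 2 ^ (-|α|) ≤ 1 :=
    mul_le_one₀ (Real.rpow_le_one_of_one_le_of_nonpos one_le_two (by linarith)) (by positivity)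
      (Real.rpow_le_one_of_one_le_of_nonpos one_le_two (by simp))
  have h2 : 0 ≤ (1 - a) ^ (γ + 1) - (1 - b) ^ (γ + 1) :=
    sub_nonneg.2 (Real.rpow_le_rpow (by linarith) (by linarith) hγ1.le)
  calc coverConst α β lo γ * M * ((1 - a) ^ (γ + 1) - (1 - b) ^ (γ + 1))
      = (2 ^ (β - γ) * 2 ^ (-|α|)) * (lo * (2 ^ (α - γ) * 2 ^ (-|β|)) *
        (((1 - a) ^ (γ + 1) - (1 - b) ^ (γ + 1)) / (γ + 1)) * M) := by
        rw [coverConst]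
        ring
    _ ≤ _ := mul_le_of_le_one_left (by positivity) h1

theorem IsModifiedJacobi.covers (h : IsModifiedJacobi g α β lo hi) (hlo : 0 < lo)
    {γ : ℝ} (hγ : -1 < γ) (hαγ : α ≤ γ) (hβγ : β ≤ γ) (hM : 1 ≤ M)
    (hx : Equidistributed (jacobiWeight g α β) x) :
    Covers (γ + 1) (coverConst α β lo γ * M) (Set.range fun m => (x m : ℝ)) := by
  intro a b ha hab hb hmass
  obtain ⟨m, hm⟩ := h.exists_node_mem hlo hM hx (by linarith) hab hb
    (h.lt_integral hlo hγ hαγ hβγ hM ha hab hb hmass)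
  exact ⟨_, ⟨m, rfl⟩, hm⟩

theorem IsModifiedJacobi.covers_neg (h : IsModifiedJacobi g α β lo hi) (hlo : 0 < lo)
    {γ : ℝ} (hγ : -1 < γ) (hαγ : α ≤ γ) (hβγ : β ≤ γ) (hM : 1 ≤ M)
    (hx : Equidistributed (jacobiWeight g α β) x) :
    Covers (γ + 1) (coverConst α β lo γ * M) (-Set.range fun m => (x m : ℝ)) := by
  intro a b ha hab hb hmass
  rw [coverConst_comm] at hmass
  have h1 := h.comp_neg.lt_integral hlo hγ hβγ hαγ hM ha hab hb hmass
  have h2 : ∫ t in a..b, jacobiWeight (fun x => g (-x)) β α t =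
      ∫ t in (-b)..(-a), jacobiWeight g α β t := by
    rw [← intervalIntegral.integral_comp_neg]
    refine intervalIntegral.integral_congr fun x _ => ?_
    simp only [jacobiWeight, sub_neg_eq_add, ← sub_eq_add_neg]
    ring
  rw [h2] at h1
  obtain ⟨m, hm1, hm2⟩ := h.exists_node_mem hlo hM hx (by linarith) (by linarith)
    (by linarith) h1
  exact ⟨-(x m : ℝ), by simp, by linarith, by linarith⟩

end Weight

/-! ### Norming inequality for equidistributed nodes -/

/-- Boundedly many equidistributed nodes are uniformly separated. -/
theorem exists_separation {α β lo : ℝ} (hi : ℝ) (hα : -1 < α) (hβ : -1 < β) (hlo : 0 < lo)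
    (M₀ : ℕ) :
    ∃ δ : ℝ, 0 < δ ∧ ∀ g : ℝ → ℝ, IsModifiedJacobi g α β lo hi → ∀ M : ℕ, 1 ≤ M → M ≤ M₀ →
      ∀ x : Fin (M + 1) → I, Equidistributed (jacobiWeight g α β) x →
      ∀ i j, i ≠ j → δ ≤ |(x i : ℝ) - x j| := by
  set w₀ : ℝ → ℝ := fun x => 2 ^ |β| * (1 - x) ^ α + 2 ^ |α| * (1 + x) ^ β with hw₀
  have hw₀i : ∀ a b, IntervalIntegrable w₀ volume a b := fun a b =>
    ((intervalIntegrable_one_sub_rpow hα a b).const_mul _).add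
      ((intervalIntegrable_one_add_rpow hβ a b).const_mul _)
  have hcont : UniformContinuousOn (fun y => ∫ t in (-1 : ℝ)..y, w₀ t) (Set.Icc (-1) 1) :=
    isCompact_Icc.uniformContinuousOn_of_continuous
      (intervalIntegral.continuous_primitive hw₀i (-1)).continuousOn
  -- Distinct nodes enclose mass at least `1 / M ≥ 1 / M₀`, more than `|hi|` times this number.
  have hε : 0 < 1 / ((|hi| + 1) * ((M₀ : ℝ) + 1)) := by positivity
  obtain ⟨δ, hδ, hδ'⟩ := Metric.uniformContinuousOn_iff.1 hcont _ hε
  refine ⟨δ, hδ, ?_⟩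
  intro g h M hM hMM x hx
  have hM0 : (0 : ℝ) < M := by exact_mod_cast hM
  have key : ∀ i j, i ≠ j → (x i : ℝ) ≤ x j → δ ≤ |(x i : ℝ) - x j| := by
    intro i j hij hle
    by_contra! hlt
    have h1 := hδ' (x i) (x i).2 (x j) (x j).2 hlt
    rw [Real.dist_eq, abs_sub_comm, intervalIntegral.integral_interval_sub_left (hw₀i _ _)
      (hw₀i _ _)] at h1
    have h2 := h.integral_le hlo hα hβ (x i).2.1 hle (x j).2.2
    have h3 : ((j : ℕ) : ℝ) / M - ((i : ℕ) : ℝ) / M =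
        ∫ t in (x i : ℝ)..(x j : ℝ), jacobiWeight g α β t := by
      rw [hx i, hx j, intervalIntegral.integral_interval_sub_left]
      · exact h.intervalIntegrable ⟨le_rfl, by norm_num⟩ (x j).2
      · exact h.intervalIntegrable ⟨le_rfl, by norm_num⟩ (x i).2
    have h4 := h.integral_nonneg hlo (x i).2.1 hle (x j).2.2
    rw [← h3, ← sub_div] at h4 h2
    have h5 : (0 : ℝ) ≤ (j : ℕ) - (i : ℕ) := by
      by_contra! hneg
      exact absurd h4 (not_le.2 (div_neg_of_neg_of_pos hneg hM0))
    have h6 : (1 : ℝ) ≤ (j : ℕ) - (i : ℕ) := by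
      have h7 : (i : ℕ) ≤ j := by
        have : ((i : ℕ) : ℝ) ≤ (j : ℕ) := by linarith
        exact_mod_cast this
      have h8 : (i : ℕ) + 1 ≤ j := Nat.lt_of_le_of_ne h7 fun h => hij (Fin.ext h)
      have : ((i : ℕ) : ℝ) + 1 ≤ (j : ℕ) := by exact_mod_cast h8
      linarith
    have h9 : 1 / (M : ℝ) ≤ |hi| * (1 / ((|hi| + 1) * ((M₀ : ℝ) + 1))) := by
      calc 1 / (M : ℝ) ≤ (((j : ℕ) : ℝ) - (i : ℕ)) / M := by gcongr
        _ ≤ _ := h2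
        _ ≤ _ := by
          gcongr
          exact (le_abs_self _).trans h1.le
    have h10 : |hi| * (1 / ((|hi| + 1) * ((M₀ : ℝ) + 1))) < 1 / M := by
      have hMM' : (M : ℝ) ≤ M₀ := by exact_mod_cast hMM
      rw [mul_one_div, div_lt_div_iff₀ (by positivity) hM0]
      nlinarith [abs_nonneg hi]
    linarith
  intro i j hij
  rcases le_total (x i : ℝ) (x j) with hle | hle
  · exact key i j hij hle
  · rw [abs_sub_comm]
    exact key j i hij.symm hle

/-- Equidistributed nodes are norming for polynomials of degree `N ≲ M^{1 / (2 (γ + 1))}`. -/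
theorem exists_norming {α β lo hi γ : ℝ} (hα : -1 < α) (hβ : -1 < β) (hlo : 0 < lo)
    (hγ : γ = max (max α β) (-1 / 2)) :
    ∃ c₀ : ℝ, 0 ≤ c₀ ∧ (-1 / 2 < γ → c₀ = 0) ∧
      ∀ c₁ c₂ : ℝ, c₀ < c₁ → ∃ C : ℝ, 0 < C ∧
        ∀ g : ℝ → ℝ, IsModifiedJacobi g α β lo hi →
        ∀ M N : ℕ, 1 ≤ N → N ≤ M →
          c₁ * (N : ℝ) ^ (2 * (γ + 1)) ≤ (M : ℝ) → (M : ℝ) ≤ c₂ * (N : ℝ) ^ (2 * (γ + 1)) →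
        ∀ x : Fin (M + 1) → I, Equidistributed (jacobiWeight g α β) x →
        ∀ p : ℂ[X], p.natDegree ≤ N → ∀ A : ℝ, 0 ≤ A → (∀ m, ‖polyFun p (x m)‖ ≤ A) →
          ‖polyFun p‖ ≤ C * A := by
  have hαγ : α ≤ γ := hγ ▸ (le_max_left α β).trans (le_max_left _ _)
  have hβγ : β ≤ γ := hγ ▸ (le_max_right α β).trans (le_max_left _ _)
  have hγ2 : -1 / 2 ≤ γ := hγ ▸ le_max_right _ _
  have hγ1 : -1 < γ := by linarith
  set c' := coverConst α β lo γ
  have hc' : 0 < c' := coverConst_pos hlo hγ1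
  refine ⟨if -1 / 2 < γ then 0 else 48 / c', ?_, fun h => if_pos h, ?_⟩
  · split_ifs
    · exact le_rfl
    · positivity
  intro c₁ c₂ hc₁
  have hc₁0 : 0 < c₁ := by
    refine lt_of_le_of_lt ?_ hc₁
    split_ifs
    · exact le_rfl
    · positivity
  obtain ⟨C₁, N₀, hC₁, hlarge⟩ := exists_norm_eval_le_of_covers (q := γ + 1) (c := c' * c₁)
    (by linarith) (by positivity) (by
      by_cases h : -1 / 2 < γ
      · left
        linarith
      · right
        rw [if_neg h, div_lt_iff₀ hc'] at hc₁
        linarith)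
  -- For `N ≤ N₀` the upper bound on `M` gives `M ≤ M₀`: the case of boundedly many nodes.
  obtain ⟨M₀, hM₀⟩ := exists_nat_ge (|c₂| * (N₀ : ℝ) ^ (2 * (γ + 1)))
  obtain ⟨δ, hδ, hsep⟩ := exists_separation hi hα hβ hlo M₀
  set δ' := min δ 2
  have hδ' : 0 < δ' := lt_min hδ two_pos
  have hδ2 : 1 ≤ 2 / δ' := (one_le_div hδ').2 (min_le_right _ _)
  set C₂ : ℝ := (M₀ + 1 : ℕ) * (2 / δ') ^ M₀
  have hC₂ : 0 < C₂ := by positivity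
  refine ⟨C₁ + C₂, by positivity, ?_⟩
  intro g h M N hN hNM hM1 hM2 x hx p hp A hA0 hA
  have hM : 1 ≤ M := hN.trans hNM
  rw [ContinuousMap.norm_le _ (by positivity)]
  intro t
  rcases le_total N₀ N with hNN | hNN
  · have h1 := hlarge N hNN hN (c' * M) (by
        rw [mul_assoc]
        gcongr) _ (h.covers hlo hγ1 hαγ hβγ hM hx)
      (h.covers_neg hlo hγ1 hαγ hβγ hM hx) p hp A hA0 (by
        rintro _ ⟨m, rfl⟩
        exact hA m) t t.2
    refine h1.trans ?_
    gcongr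
    linarith
  · have hMM : M ≤ M₀ := by
      have : (M : ℝ) ≤ M₀ := by
        calc (M : ℝ) ≤ c₂ * (N : ℝ) ^ (2 * (γ + 1)) := hM2
          _ ≤ |c₂| * (N₀ : ℝ) ^ (2 * (γ + 1)) := by
            have h1 : (N : ℝ) ≤ N₀ := by exact_mod_cast hNN
            have h2 : (N : ℝ) ^ (2 * (γ + 1)) ≤ (N₀ : ℝ) ^ (2 * (γ + 1)) :=
              Real.rpow_le_rpow (by positivity) h1 (by linarith)
            exact mul_le_mul (le_abs_self _) h2 (by positivity) (abs_nonneg _)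
          _ ≤ M₀ := hM₀
      exact_mod_cast this
    have h1 := norm_eval_le_of_separated (n := M + 1) (p := p) (v := fun m => ((x m : ℝ) : ℂ))
      (d := δ') (D := 2) (A := A) (z := ((t : ℝ) : ℂ)) (by
        refine (degree_le_natDegree).trans_lt ?_
        exact_mod_cast Nat.lt_succ_of_le (hp.trans hNM)) hδ' (by
        intro i j hij
        rw [← Complex.ofReal_sub, Complex.norm_real, Real.norm_eq_abs]
        exact (min_le_left _ _).trans (hsep g h M hM hMM x hx i j hij)) hA (by
        intro i
        rw [← Complex.ofReal_sub, Complex.norm_real, Real.norm_eq_abs, abs_le]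
        have h1 := t.2
        have h2 := (x i).2
        constructor <;> linarith [h1.1, h1.2, h2.1, h2.2])
    refine h1.trans ?_
    have h2 : ((M + 1 : ℕ) : ℝ) * (2 / δ') ^ (M + 1 - 1) ≤ C₂ := by
      have : ((M + 1 : ℕ) : ℝ) ≤ (M₀ + 1 : ℕ) := by exact_mod_cast Nat.succ_le_succ hMM
      rw [Nat.add_sub_cancel]
      exact mul_le_mul this (pow_le_pow_right₀ hδ2 hMM) (by positivity) (by positivity)
    gcongr
    linarith

/-! ### Polynomial approximation of functions analytic in an ellipse -/

/-- By the parallelogram law the distances to the foci add up to `‖w‖ + ‖w‖⁻¹`, which increases for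
`‖w‖ ≥ 1`. -/
theorem joukowsky_mem_bernsteinEllipse {θ : ℝ} {w : ℂ} (hw : 1 ≤ ‖w‖) (hwθ : ‖w‖ < θ) :
    (w + w⁻¹) / 2 ∈ bernsteinEllipse θ := by
  have hn : 0 < ‖w‖ := by linarith
  have hw0 : w ≠ 0 := norm_pos_iff.1 hn
  have h1 : (w + w⁻¹) / 2 - 1 = (w - 1) ^ 2 / (2 * w) := by
    field_simp
    ring
  have h2 : (w + w⁻¹) / 2 + 1 = (w + 1) ^ 2 / (2 * w) := by
    field_simp
    ring
  have h3 : ‖w - 1‖ ^ 2 + ‖w + 1‖ ^ 2 = 2 * (‖w‖ ^ 2 + 1) := by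
    have := parallelogram_law_with_norm ℝ w 1
    rw [norm_one] at this
    nlinarith
  change ‖(w + w⁻¹) / 2 - 1‖ + ‖(w + w⁻¹) / 2 + 1‖ < θ + θ⁻¹
  rw [h1, h2, norm_div, norm_div, norm_pow, norm_pow, norm_mul, Complex.norm_ofNat, ← add_div, h3,
    mul_div_mul_left _ _ two_ne_zero]
  have hθ : 0 < θ := hn.trans hwθ
  have h4 : θ + θ⁻¹ = (θ ^ 2 + 1) / θ := by field_simp
  rw [h4, div_lt_div_iff₀ hn hθ]
  nlinarith [mul_pos (sub_pos.2 hwθ) (show 0 < ‖w‖ * θ - 1 by nlinarith)]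

theorem ofReal_mem_bernsteinEllipse {θ t : ℝ} (hθ : 1 < θ) (ht : t ∈ Set.Icc (-1 : ℝ) 1) :
    (t : ℂ) ∈ bernsteinEllipse θ := by
  change ‖(t : ℂ) - 1‖ + ‖(t : ℂ) + 1‖ < θ + θ⁻¹
  have hθ0 : 0 < θ := by linarith
  rw [← Complex.ofReal_one, ← Complex.ofReal_sub, ← Complex.ofReal_add, Complex.norm_real,
    Complex.norm_real, Real.norm_eq_abs, Real.norm_eq_abs, abs_of_nonpos (by linarith [ht.2]),
    abs_of_nonneg (by linarith [ht.1])]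
  have h4 : θ + θ⁻¹ = (θ ^ 2 + 1) / θ := by field_simp
  have : 2 < θ + θ⁻¹ := by
    rw [h4, lt_div_iff₀ hθ0]
    nlinarith
  linarith

/-- Under the Joukowsky map the integral is taken over the unit circle; moving the contour to radius
`r` gains `r⁻ⁿ`. It serves to bound Chebyshev coefficients. -/
theorem norm_integral_circle_le {θ : ℝ} {φ : ℂ → ℂ} {B : ℝ}
    (hφ : AnalyticOnNhd ℂ φ (bernsteinEllipse θ)) (hB : ∀ z ∈ bernsteinEllipse θ, ‖φ z‖ ≤ B)
    (n : ℕ) {r : ℝ} (hr : 1 ≤ r) (hrθ : r < θ) :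
    ‖∫ t in (0 : ℝ)..2 * Real.pi, (circleMap 0 1 t)⁻¹ ^ n * φ (Real.cos t : ℂ)‖ ≤
      2 * Real.pi * (B / r ^ n) := by
  let G : ℂ → ℂ := fun w => w⁻¹ ^ n * φ ((w + w⁻¹) / 2)
  have hr0 : 0 < r := by linarith
  have hd : ∀ w : ℂ, 1 ≤ ‖w‖ → ‖w‖ ≤ r → DifferentiableAt ℂ G w := by
    intro w h1 h2
    have hw0 : w ≠ 0 := norm_pos_iff.1 (by linarith)
    have hi : DifferentiableAt ℂ (fun w : ℂ => w⁻¹) w := differentiableAt_inv hw0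
    refine (hi.pow n).mul ?_
    have hj := (hφ _ (joukowsky_mem_bernsteinEllipse h1 (h2.trans_lt hrθ))).differentiableAt
    exact hj.comp w ((differentiableAt_id.add hi).div_const 2)
  have hshift := Complex.circleIntegral_sub_center_inv_smul_eq_of_differentiable_on_annulus_off_countable
    (c := 0) (f := G) one_pos hr Set.countable_empty
    (fun w hw => (hd w (by simpa using hw.2) (by simpa using hw.1)).continuousAt.continuousWithinAt)
    (fun w hw => hd w (by
      have := hw.1.2
      simp only [mem_closedBall_zero_iff, not_le] at this
      exact this.le) (by
      have := hw.1.1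
      rw [mem_ball_zero_iff] at this
      exact this.le))
  have hone : (∮ z in C(0, 1), (z - 0)⁻¹ • G z) =
      Complex.I * ∫ t in (0 : ℝ)..2 * Real.pi, (circleMap 0 1 t)⁻¹ ^ n * φ (Real.cos t : ℂ) := by
    rw [circleIntegral, ← intervalIntegral.integral_const_mul]
    refine intervalIntegral.integral_congr fun t _ => ?_
    have hc : circleMap 0 1 t ≠ 0 := circleMap_ne_center one_ne_zero
    have hcos : (circleMap 0 1 t + (circleMap 0 1 t)⁻¹) / 2 = (Real.cos t : ℂ) := by
      rw [circleMap, Complex.ofReal_cos, Complex.cos]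
      simp [← Complex.exp_neg]
    simp only [deriv_circleMap, sub_zero, smul_eq_mul, G, hcos]
    field_simp
  have hbound : ‖∮ z in C(0, r), (z - 0)⁻¹ • G z‖ ≤ 2 * Real.pi * r * (r⁻¹ * (B / r ^ n)) := by
    refine circleIntegral.norm_integral_le_of_norm_le_const hr0.le fun z hz => ?_
    rw [mem_sphere_zero_iff_norm] at hz
    have h1 := hB _ (joukowsky_mem_bernsteinEllipse (w := z) (hz ▸ hr) (hz ▸ hrθ))
    simp only [G, sub_zero, smul_eq_mul, norm_mul, norm_inv, norm_pow, hz]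
    refine mul_le_mul_of_nonneg_left ?_ (by positivity)
    rw [inv_pow, inv_mul_eq_div]
    gcongr
  have : ‖∮ z in C(0, r), (z - 0)⁻¹ • G z‖ =
      ‖∫ t in (0 : ℝ)..2 * Real.pi, (circleMap 0 1 t)⁻¹ ^ n * φ (Real.cos t : ℂ)‖ := by
    rw [hshift, hone, norm_mul, Complex.norm_I, one_mul]
  rw [← this]
  refine hbound.trans (le_of_eq ?_)
  field_simp

/-- **Bernstein's theorem**: truncated Chebyshev series of functions analytic in an ellipse. -/
theorem exists_polynomial_approx {θ : ℝ} (hθ : 1 < θ) {φ : ℂ → ℂ} {B : ℝ}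
    (hφ : AnalyticOnNhd ℂ φ (bernsteinEllipse θ)) (hB : ∀ z ∈ bernsteinEllipse θ, ‖φ z‖ ≤ B)
    (N : ℕ) :
    ∃ p : ℂ[X], p.natDegree ≤ N ∧ ∀ t ∈ Set.Icc (-1 : ℝ) 1,
      ‖φ (t : ℂ) - p.eval (t : ℂ)‖ ≤ 2 * B / (θ - 1) / θ ^ N := by
  have hθ0 : 0 < θ := by linarith
  have : Fact (0 < 2 * Real.pi) := ⟨Real.two_pi_pos⟩
  have hφc : Continuous fun y : Set.Icc (-1 : ℝ) 1 => φ ((y : ℝ) : ℂ) := by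
    refine continuous_iff_continuousAt.2 fun y => ?_
    exact (hφ _ (ofReal_mem_bernsteinEllipse hθ y.2)).continuousAt.comp
      (f := fun y : Set.Icc (-1 : ℝ) 1 => ((y : ℝ) : ℂ)) (by fun_prop)
  have hre : ∀ u : AddCircle (2 * Real.pi), (fourier 1 u : ℂ).re ∈ Set.Icc (-1 : ℝ) 1 := by
    intro u
    exact abs_le.1 ((Complex.abs_re_le_norm _).trans
      (((fourier 1).norm_coe_le_norm u).trans (fourier_norm 1).le))
  let f : C(AddCircle (2 * Real.pi), ℂ) :=
    ⟨fun u => φ (((fourier 1 u : ℂ).re : ℝ) : ℂ),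
      hφc.comp ((Complex.continuous_re.comp (map_continuous (fourier 1))).subtype_mk hre)⟩
  have hfour : ∀ (n : ℤ) (t : ℝ),
      (fourier n (t : AddCircle (2 * Real.pi)) : ℂ) = Complex.exp (n * t * Complex.I) := by
    intro n t
    rw [fourier_coe_apply]
    congr 1
    have : (Real.pi : ℂ) ≠ 0 := by exact_mod_cast Real.pi_ne_zero
    push_cast
    field_simp
  have hf : ∀ t : ℝ, f (t : AddCircle (2 * Real.pi)) = φ (Real.cos t : ℂ) := by
    intro t
    change φ (((fourier 1 (t : AddCircle (2 * Real.pi)) : ℂ).re : ℝ) : ℂ) = _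
    rw [hfour, Int.cast_one, one_mul, Complex.exp_ofReal_mul_I_re]
  set a : ℤ → ℂ := fun n => fourierCoeff f n with ha
  have hneg : ∀ n, a (-n) = a n := by
    intro n
    simp only [ha, fourierCoeff]
    rw [← integral_neg_eq_self]
    refine integral_congr_ae (Eventually.of_forall fun u => ?_)
    have h1 : f (-u) = f u := by
      change φ (((fourier 1 (-u) : ℂ).re : ℝ) : ℂ) = φ (((fourier 1 u : ℂ).re : ℝ) : ℂ)
      simp [fourier_apply, AddCircle.toCircle_neg]
    simp only [h1, neg_neg]
    congr 1
    simp [fourier_apply]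
  have hcoef : ∀ n : ℕ, ‖a n‖ ≤ B / θ ^ n := by
    intro n
    have h1 : ∀ r : ℝ, 1 ≤ r → r < θ → ‖a n‖ ≤ B / r ^ n := by
      intro r hr hrθ
      have h2 := norm_integral_circle_le hφ hB n hr hrθ
      have h3 : a n = (1 / (2 * Real.pi) : ℝ) •
          ∫ t in (0 : ℝ)..2 * Real.pi, (circleMap 0 1 t)⁻¹ ^ n * φ (Real.cos t : ℂ) := by
        rw [ha]
        simp only
        rw [fourierCoeff_eq_intervalIntegral _ _ 0, zero_add]
        congr 1
        refine intervalIntegral.integral_congr fun t _ => ?_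
        simp only [hfour, hf, smul_eq_mul]
        congr 1
        rw [circleMap, zero_add, Complex.ofReal_one, one_mul, ← Complex.exp_neg,
          ← Complex.exp_nat_mul]
        congr 1
        push_cast
        ring
      rw [h3, norm_smul, Real.norm_of_nonneg (by positivity), one_div,
        inv_mul_le_iff₀ Real.two_pi_pos]
      exact h2
    -- The ellipse is open, so radius `θ` itself is reached only as a limit.
    have h4 : Tendsto (fun r : ℝ => B / r ^ n) (𝓝[<] θ) (𝓝 (B / θ ^ n)) := by
      have : ContinuousAt (fun r : ℝ => B / r ^ n) θ := by
        refine continuousAt_const.div (by fun_prop) (by positivity)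
      exact this.tendsto.mono_left nhdsWithin_le_nhds
    refine ge_of_tendsto h4 ?_
    filter_upwards [Ioo_mem_nhdsLT hθ] with r hr
    exact h1 r hr.1.le hr.2
  have hgeo : HasSum (fun n : ℕ => B / θ ^ n) (B * (1 - θ⁻¹)⁻¹) := by
    have := (hasSum_geometric_of_lt_one (inv_nonneg.2 hθ0.le) (inv_lt_one_of_one_lt₀ hθ)).mul_left B
    simpa [div_eq_mul_inv] using this
  have hsumm : Summable (fourierCoeff f) := by
    refine Summable.of_nat_of_neg ?_ ?_
    · exact Summable.of_norm_bounded hgeo.summable hcoef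
    · refine Summable.of_norm_bounded hgeo.summable fun n => ?_
      rw [show fourierCoeff f (-(n : ℤ)) = a n from hneg n]
      exact hcoef n
  -- Pairing the frequencies `n` and `-n` counts frequency zero twice, hence the summand `a 0`.
  have hser : ∀ t : ℝ, HasSum (fun n : ℕ => 2 * a n * Complex.cos (n * t))
      (φ (Real.cos t : ℂ) + a 0) := by
    intro t
    have h1 := (has_pointwise_sum_fourier_series_of_summable hsumm
      (t : AddCircle (2 * Real.pi))).nat_add_neg
    rw [hf, fourier_zero, smul_eq_mul, mul_one] at h1
    refine h1.congr_fun ?_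
    intro n
    rw [show fourierCoeff f (-(n : ℤ)) = a n from hneg n,
      show fourierCoeff f (n : ℤ) = a n from rfl, hfour, hfour, Complex.cos]
    push_cast
    simp only [smul_eq_mul]
    ring_nf
  refine ⟨∑ n ∈ Finset.range (N + 1), C (2 * a n) * Chebyshev.T ℂ n - C (a 0), ?_, ?_⟩
  · refine (natDegree_sub_le _ _).trans (max_le ?_ (by simp))
    refine natDegree_sum_le_of_forall_le _ _ fun n hn => ?_
    refine (natDegree_C_mul_le _ _).trans ?_
    rw [Chebyshev.natDegree_T, Int.natAbs_natCast]
    exact Nat.lt_succ_iff.1 (Finset.mem_range.1 hn)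
  · intro t ht
    obtain ⟨s, rfl⟩ : ∃ s : ℝ, Real.cos s = t := ⟨Real.arccos t, Real.cos_arccos ht.1 ht.2⟩
    have h1 := (hasSum_nat_add_iff' (N + 1)).2 (hser s)
    have h2 : φ (Real.cos s : ℂ) - (∑ n ∈ Finset.range (N + 1), C (2 * a n) * Chebyshev.T ℂ n -
        C (a 0)).eval (Real.cos s : ℂ) = φ (Real.cos s : ℂ) + a 0 -
        ∑ n ∈ Finset.range (N + 1), 2 * a n * Complex.cos (n * s) := by
      have h3 : ∀ n : ℕ, (Chebyshev.T ℂ n).eval (Real.cos s : ℂ) = Complex.cos (n * s) := by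
        intro n
        rw [Complex.ofReal_cos, Chebyshev.T_complex_cos]
        push_cast
        rfl
      simp only [eval_sub, eval_finsetSum, eval_mul, eval_C, h3]
      ring
    rw [h2, ← h1.tsum_eq]
    have h4 : HasSum (fun n : ℕ => 2 / θ ^ (N + 1) * (B / θ ^ n))
        (2 / θ ^ (N + 1) * (B * (1 - θ⁻¹)⁻¹)) := hgeo.mul_left _
    have h5 : 2 / θ ^ (N + 1) * (B * (1 - θ⁻¹)⁻¹) = 2 * B / (θ - 1) / θ ^ N := by
      have : θ - 1 ≠ 0 := by linarith
      have h6 : 1 - θ⁻¹ = (θ - 1) / θ := by field_simp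
      rw [h6, inv_div, pow_succ]
      field_simp
    rw [← h5]
    refine tsum_of_norm_bounded h4 fun n => ?_
    have h7 : ‖Complex.cos (((n + (N + 1) : ℕ) : ℂ) * s)‖ ≤ 1 := by
      rw [← Complex.ofReal_natCast, ← Complex.ofReal_mul, ← Complex.ofReal_cos, Complex.norm_real]
      exact Real.abs_cos_le_one _
    rw [norm_mul, norm_mul, Complex.norm_ofNat]
    calc 2 * ‖a (n + (N + 1) : ℕ)‖ * ‖Complex.cos (((n + (N + 1) : ℕ) : ℂ) * s)‖
        ≤ 2 * (B / θ ^ (n + (N + 1))) * 1 := by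
          have h8 := hcoef (n + (N + 1))
          refine mul_le_mul (by gcongr) h7 (norm_nonneg _) ?_
          exact mul_nonneg zero_le_two ((norm_nonneg _).trans h8)
      _ = _ := by
          rw [pow_add]
          field_simp

/-! ### Least squares as a projection on grid values -/

section LeastSquares

variable {M : ℕ} (x : Fin (M + 1) → I)

/-- The values of a continuous function at the nodes. -/
noncomputable def gridValues (f : C(I, ℂ)) : EuclideanSpace ℂ (Fin (M + 1)) :=
  WithLp.toLp 2 fun m => f (x m)

/-- The values of a polynomial at the nodes, as a linear map. -/
noncomputable def gridEval : ℂ[X] →ₗ[ℂ] EuclideanSpace ℂ (Fin (M + 1)) where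
  toFun p := gridValues x (polyFun p)
  map_add' p q := by
    ext m
    simp [polyFun, gridValues]
  map_smul' c p := by
    ext m
    simp [polyFun, gridValues]

/-- The values at the nodes of the polynomials of degree at most `N`. -/
noncomputable def gridSpace (N : ℕ) : Submodule ℂ (EuclideanSpace ℂ (Fin (M + 1))) :=
  (Polynomial.degreeLE ℂ (N : WithBot ℕ)).map (gridEval x)

variable {x} {N : ℕ} {f : C(I, ℂ)} {p : ℂ[X]}

theorem residual_eq_norm_sq : residual x f p = ‖gridValues x f - gridEval x p‖ ^ 2 := by
  rw [EuclideanSpace.norm_sq_eq]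
  rfl

theorem gridEval_mem_gridSpace (hp : p.natDegree ≤ N) : gridEval x p ∈ gridSpace x N :=
  Submodule.mem_map_of_mem (mem_degreeLE.2 (natDegree_le_iff_degree_le.1 hp))

/-- A nearest point in a subspace is the orthogonal projection, so the grid values do not depend on
the choice of the minimiser. -/
theorem IsLeastSquares.gridEval_eq (h : IsLeastSquares x N f p) :
    gridEval x p = (gridSpace x N).starProjection (gridValues x f) := by
  refine (Submodule.eq_starProjection_of_mem_of_inner_eq_zero (gridEval_mem_gridSpace h.1) ?_).symm
  rw [← Submodule.norm_eq_iInf_iff_inner_eq_zero _ (gridEval_mem_gridSpace h.1)]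
  refine le_antisymm (le_ciInf ?_) (ciInf_le ⟨0, by rintro _ ⟨y, rfl⟩; exact norm_nonneg _⟩
    (⟨_, gridEval_mem_gridSpace h.1⟩ : gridSpace x N))
  rintro ⟨_, q, hq, rfl⟩
  have h1 := h.2 q (natDegree_le_iff_degree_le.2 (mem_degreeLE.1 hq))
  rw [residual_eq_norm_sq, residual_eq_norm_sq] at h1
  exact (sq_le_sq₀ (norm_nonneg _) (norm_nonneg _)).1 h1

theorem IsLeastSquares.norm_gridEval_sub_le {f' : C(I, ℂ)} {p' : ℂ[X]}
    (h : IsLeastSquares x N f p) (h' : IsLeastSquares x N f' p') :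
    ‖gridEval x (p - p')‖ ≤ ‖gridValues x (f - f')‖ := by
  rw [map_sub, h.gridEval_eq, h'.gridEval_eq, ← map_sub]
  exact (Submodule.norm_starProjection_apply_le _ _)

theorem norm_gridValues_le : ‖gridValues x f‖ ≤ √(M + 1 : ℕ) * gridNorm x f := by
  have h0 : 0 ≤ gridNorm x f := norm_nonneg _
  rw [EuclideanSpace.norm_eq]
  refine Real.sqrt_le_iff.2 ⟨by positivity, ?_⟩
  rw [mul_pow, Real.sq_sqrt (by positivity)]
  calc ∑ m, ‖gridValues x f m‖ ^ 2 ≤ ∑ _m : Fin (M + 1), gridNorm x f ^ 2 := by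
        refine Finset.sum_le_sum fun m _ => ?_
        gcongr
        exact norm_le_pi_norm (fun m => f (x m) : Fin (M + 1) → ℂ) m
    _ = _ := by simp

theorem gridNorm_le_norm : gridNorm x f ≤ ‖f‖ :=
  (pi_norm_le_iff_of_nonneg (norm_nonneg _)).2 fun m => f.norm_coe_le_norm (x m)

variable {C : ℝ}

/-- Least squares is Lipschitz with respect to the grid norm if the nodes are norming. -/
theorem norm_leastSquares_sub_le (hM : 1 ≤ M) (hC0 : 0 ≤ C)
    (hC : ∀ p : ℂ[X], p.natDegree ≤ N → ∀ A : ℝ, 0 ≤ A → (∀ m, ‖polyFun p (x m)‖ ≤ A) →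
      ‖polyFun p‖ ≤ C * A) (f f' : C(I, ℂ)) :
    ‖leastSquares x N f - leastSquares x N f'‖ ≤ 2 * C * √M * gridNorm x (f - f') := by
  have h := (exists_isLeastSquares x N f).choose_spec
  have h' := (exists_isLeastSquares x N f').choose_spec
  set p := (exists_isLeastSquares x N f).choose
  set p' := (exists_isLeastSquares x N f').choose
  have hsub : leastSquares x N f - leastSquares x N f' = polyFun (p - p') := by
    ext t
    simp [leastSquares, polyFun, p, p']
  have h0 : 0 ≤ gridNorm x (f - f') := norm_nonneg _
  rw [hsub]
  refine (hC (p - p') ((natDegree_sub_le _ _).trans (max_le h.1 h'.1)) _ (norm_nonneg _)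
    fun m => PiLp.norm_apply_le (gridEval x (p - p')) m).trans ?_
  have h1 := (h.norm_gridEval_sub_le h').trans norm_gridValues_le
  have h2 : √((M + 1 : ℕ) : ℝ) ≤ 2 * √M := by
    have h3 : (1 : ℝ) ≤ M := by exact_mod_cast hM
    rw [Real.sqrt_le_left (by positivity), mul_pow, Real.sq_sqrt (by positivity)]
    push_cast
    linarith
  calc C * ‖gridEval x (p - p')‖ ≤ C * (2 * √M * gridNorm x (f - f')) := by
        gcongr
        refine h1.trans ?_
        gcongr
    _ = _ := by ring

/-- The minimiser agrees with `q` at the nodes, and the norming inequality with `A = 0` then forces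
equality. -/
theorem leastSquares_polyFun
    (hC : ∀ p : ℂ[X], p.natDegree ≤ N → ∀ A : ℝ, 0 ≤ A → (∀ m, ‖polyFun p (x m)‖ ≤ A) →
      ‖polyFun p‖ ≤ C * A) {q : ℂ[X]} (hq : q.natDegree ≤ N) :
    leastSquares x N (polyFun q) = polyFun q := by
  have h := (exists_isLeastSquares x N (polyFun q)).choose_spec
  set p := (exists_isLeastSquares x N (polyFun q)).choose
  have h' : IsLeastSquares x N (polyFun q) q := by
    refine ⟨hq, fun r _ => ?_⟩
    have h0 : residual x (polyFun q) q = 0 := by simp [residual]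
    rw [h0]
    exact Finset.sum_nonneg fun _ _ => by positivity
  have h1 : ‖gridEval x (p - q)‖ ≤ 0 := by
    have h2 : gridValues x (0 : C(I, ℂ)) = 0 := rfl
    simpa only [sub_self, h2, norm_zero] using h.norm_gridEval_sub_le h'
  have h2 := hC (p - q) ((natDegree_sub_le _ _).trans (max_le h.1 hq)) 0 le_rfl
    fun m => (PiLp.norm_apply_le (gridEval x (p - q)) m).trans h1
  rw [mul_zero] at h2
  have h3 : polyFun (p - q) = polyFun p - polyFun q := by
    ext t
    simp [polyFun]
  rw [h3] at h2
  exact sub_eq_zero.1 (norm_le_zero_iff.1 h2)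

theorem condNumber_le (hM : 1 ≤ M) (hC0 : 0 ≤ C)
    (hC : ∀ p : ℂ[X], p.natDegree ≤ N → ∀ A : ℝ, 0 ≤ A → (∀ m, ‖polyFun p (x m)‖ ≤ A) →
      ‖polyFun p‖ ≤ C * A) :
    condNumber x (leastSquares x N) ≤ ENNReal.ofReal (2 * C * √M) := by
  -- Any `δ` would do, since the Lipschitz bound is global.
  refine iSup_le fun f => (iInf₂_le 1 one_pos).trans (iSup₂_le fun h hh => ?_)
  refine ENNReal.ofReal_le_ofReal ?_
  rw [div_le_iff₀ hh.1]
  simpa using norm_leastSquares_sub_le hM hC0 hC (f + h) f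

/-- Constants are reproduced, so perturbing `0` by the constant `δ` gives a quotient of at least
`1`. -/
theorem one_le_condNumber
    (hC : ∀ p : ℂ[X], p.natDegree ≤ N → ∀ A : ℝ, 0 ≤ A → (∀ m, ‖polyFun p (x m)‖ ≤ A) →
      ‖polyFun p‖ ≤ C * A) :
    1 ≤ condNumber x (leastSquares x N) := by
  refine le_iSup_of_le 0 (le_iInf₂ fun δ hδ => ?_)
  have hval : ∀ t, polyFun (Polynomial.C (δ : ℂ)) t = δ := fun t => by simp [polyFun]
  have hgrid : gridNorm x (polyFun (Polynomial.C (δ : ℂ))) = δ := by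
    simp only [gridNorm, hval]
    rw [pi_norm_const, Complex.norm_real, Real.norm_of_nonneg hδ.le]
  have hzero : leastSquares x N 0 = 0 := by
    have h1 : polyFun 0 = 0 := by
      ext t
      simp [polyFun]
    have h2 := leastSquares_polyFun hC (q := 0) (by simp)
    rwa [h1] at h2
  refine le_iSup₂_of_le (polyFun (Polynomial.C (δ : ℂ))) ⟨by rwa [hgrid], hgrid.le⟩ ?_
  rw [zero_add, hzero, sub_zero, leastSquares_polyFun hC (by simp), ← ENNReal.ofReal_one]
  refine ENNReal.ofReal_le_ofReal ?_
  have h0 : 0 < gridNorm x (polyFun (Polynomial.C (δ : ℂ))) := by rwa [hgrid]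
  rw [one_le_div h0]
  exact gridNorm_le_norm

/-- Least squares is quasi-optimal if the nodes are norming. -/
theorem norm_sub_leastSquares_le (hM : 1 ≤ M) (hC0 : 0 ≤ C)
    (hC : ∀ p : ℂ[X], p.natDegree ≤ N → ∀ A : ℝ, 0 ≤ A → (∀ m, ‖polyFun p (x m)‖ ≤ A) →
      ‖polyFun p‖ ≤ C * A) (f : C(I, ℂ)) {q : ℂ[X]} (hq : q.natDegree ≤ N) :
    ‖f - leastSquares x N f‖ ≤ (1 + 2 * C) * √M * ‖f - polyFun q‖ := by
  have h1 := norm_leastSquares_sub_le hM hC0 hC f (polyFun q)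
  rw [leastSquares_polyFun hC hq] at h1
  have h2 : 1 ≤ √(M : ℝ) := Real.one_le_sqrt.2 (by exact_mod_cast hM)
  have h3 : gridNorm x (f - polyFun q) ≤ ‖f - polyFun q‖ := gridNorm_le_norm
  calc ‖f - leastSquares x N f‖
      = ‖(f - polyFun q) - (leastSquares x N f - polyFun q)‖ := by congr 1; abel
    _ ≤ ‖f - polyFun q‖ + 2 * C * √M * gridNorm x (f - polyFun q) :=
        (norm_sub_le _ _).trans (by gcongr)
    _ ≤ √M * ‖f - polyFun q‖ + 2 * C * √M * ‖f - polyFun q‖ := by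
        gcongr
        exact le_mul_of_one_le_left (norm_nonneg _) h2
    _ = _ := by ring

end LeastSquares

theorem enorm_sub_leastSquares_le {M N : ℕ} {x : Fin (M + 1) → I} {C : ℝ} (hM : 1 ≤ M)
    (hC0 : 0 ≤ C)
    (hC : ∀ p : ℂ[X], p.natDegree ≤ N → ∀ A : ℝ, 0 ≤ A → (∀ m, ‖polyFun p (x m)‖ ≤ A) →
      ‖polyFun p‖ ≤ C * A) {θ : ℝ} (hθ : 1 < θ) {φ : ℂ → ℂ} {f : C(I, ℂ)}
    (hφ : AnalyticOnNhd ℂ φ (bernsteinEllipse θ)) (hf : ∀ t : I, f t = φ ((t : ℝ) : ℂ)) :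
    ENNReal.ofReal ‖f - leastSquares x N f‖ ≤
      ENNReal.ofReal ((2 + 4 * C) * √M / (θ - 1) * θ ^ (-(N : ℝ))) *
        supNormOn (bernsteinEllipse θ) φ := by
  have hθ1 : 0 < θ - 1 := by linarith
  have hθ0 : 0 < θ := by linarith
  have hM0 : (0 : ℝ) < M := by exact_mod_cast hM
  have hK : 0 < (2 + 4 * C) * √M / (θ - 1) * θ ^ (-(N : ℝ)) := by positivity
  -- If the supremum is infinite, so is the right-hand side, because its first factor is positive.
  by_cases htop : supNormOn (bernsteinEllipse θ) φ = ⊤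
  · rw [htop, ENNReal.mul_top (by simpa using hK)]
    exact le_top
  set B := (supNormOn (bernsteinEllipse θ) φ).toReal with hBdef
  have hB : ∀ z ∈ bernsteinEllipse θ, ‖φ z‖ ≤ B := by
    intro z hz
    have h1 : ‖φ z‖ₑ ≤ supNormOn (bernsteinEllipse θ) φ :=
      le_iSup₂ (f := fun (z : ℂ) (_ : z ∈ bernsteinEllipse θ) => ‖φ z‖ₑ) z hz
    have h2 := ENNReal.toReal_mono htop h1
    rwa [toReal_enorm] at h2
  obtain ⟨q, hq, hqe⟩ := exists_polynomial_approx hθ hφ hB N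
  have hB0 : 0 ≤ B := ENNReal.toReal_nonneg
  have h3 : ‖f - polyFun q‖ ≤ 2 * B / (θ - 1) / θ ^ N := by
    rw [ContinuousMap.norm_le _ (by positivity)]
    intro t
    rw [ContinuousMap.sub_apply, hf t]
    exact hqe t t.2
  rw [← ENNReal.ofReal_toReal htop, ← ENNReal.ofReal_mul hK.le]
  refine ENNReal.ofReal_le_ofReal ((norm_sub_leastSquares_le hM hC0 hC f hq).trans ?_)
  calc (1 + 2 * C) * √M * ‖f - polyFun q‖
      ≤ (1 + 2 * C) * √M * (2 * B / (θ - 1) / θ ^ N) := by gcongr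
    _ = _ := by
        rw [Real.rpow_neg hθ0.le, Real.rpow_natCast, hBdef]
        field_simp
        ring

end LSQ

/-! ### The main theorem -/

theorem propositionp (α β lo hi γ : ℝ) (hα : -1 < α) (hβ : -1 < β) (hlo : 0 < lo)
    (hγ : γ = max (max α β) (-1 / 2)) :
    ∃ c₀ : ℝ, 0 ≤ c₀ ∧ (-1 / 2 < γ → c₀ = 0) ∧
      ∀ c₁ c₂ : ℝ, c₀ < c₁ → ∃ C : ℝ, 0 < C ∧
        ∀ g : ℝ → ℝ, LSQ.IsModifiedJacobi g α β lo hi →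
        ∀ M N : ℕ, 1 ≤ N → N ≤ M →
          c₁ * (N : ℝ) ^ (2 * (γ + 1)) ≤ (M : ℝ) → (M : ℝ) ≤ c₂ * (N : ℝ) ^ (2 * (γ + 1)) →
        ∀ x : Fin (M + 1) → LSQ.I, LSQ.Equidistributed (LSQ.jacobiWeight g α β) x →
          1 ≤ LSQ.condNumber x (LSQ.leastSquares x N) ∧
          LSQ.condNumber x (LSQ.leastSquares x N) ≤ ENNReal.ofReal (C * √(M : ℝ)) ∧
          ∀ θ : ℝ, 1 < θ → ∀ (φ : ℂ → ℂ) (f : C(LSQ.I, ℂ)),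
            AnalyticOnNhd ℂ φ (LSQ.bernsteinEllipse θ) →
            (∀ t : LSQ.I, f t = φ ((t : ℝ) : ℂ)) →
            ENNReal.ofReal ‖f - LSQ.leastSquares x N f‖ ≤
              ENNReal.ofReal (C * √(M : ℝ) / (θ - 1) *
                  θ ^ (-((M : ℝ) / c₂) ^ (1 / (2 * (γ + 1))))) *
                LSQ.supNormOn (LSQ.bernsteinEllipse θ) φ := by
  obtain ⟨c₀, hc₀, hc₀', H⟩ := LSQ.exists_norming (hi := hi) hα hβ hlo hγ
  refine ⟨c₀, hc₀, hc₀', fun c₁ c₂ hc => ?_⟩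
  obtain ⟨C, hC0, hC⟩ := H c₁ c₂ hc
  refine ⟨2 + 4 * C, by positivity, ?_⟩
  intro g hg M N hN hNM hM1 hM2 x hx
  have hnorm := hC g hg M N hN hNM hM1 hM2 x hx
  have hM : 1 ≤ M := hN.trans hNM
  refine ⟨LSQ.one_le_condNumber hnorm, (LSQ.condNumber_le hM hC0.le hnorm).trans ?_, ?_⟩
  · refine ENNReal.ofReal_le_ofReal ?_
    gcongr
    linarith
  intro θ hθ φ f hφ hf
  refine (LSQ.enorm_sub_leastSquares_le hM hC0.le hnorm hθ hφ hf).trans ?_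
  have hγ1 : 0 < 2 * (γ + 1) := by
    have : -1 / 2 ≤ γ := hγ ▸ le_max_right _ _
    linarith
  have hM0 : (0 : ℝ) < M := by exact_mod_cast hM
  have hNp : (0 : ℝ) < (N : ℝ) ^ (2 * (γ + 1)) :=
    Real.rpow_pos_of_pos (by exact_mod_cast hN) _
  have hc₂ : 0 < c₂ := pos_of_mul_pos_left (hM0.trans_le hM2) hNp.le
  -- The upper bound on `M` turns the rate `θ ^ (-N)` into one in terms of `M`.
  have hexp : ((M : ℝ) / c₂) ^ (1 / (2 * (γ + 1))) ≤ N := by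
    rw [one_div, Real.rpow_inv_le_iff_of_pos (by positivity) (by positivity) hγ1,
      div_le_iff₀ hc₂, mul_comm]
    exact hM2
  have hθ1 : 0 < θ - 1 := by linarith
  gcongr
  · exact hθ.le
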